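/- **Setting.** Let $d$ be a natural number and let $K:\mathbf R^d\times\mathbf R^d\to\mathbf R^d$ be a continuous map such that, for some constant $L$ and all $z,z',z_1,z_2\in\mathbf R^d$, $$K(z,z')+K(z',z)=0,\qquad |K(z_1,z')-K(z_2,z')|\le L|z_1-z_2|,\qquad |K(z,z_1)-K(z,z_2)|\le L|z_1-z_2|.$$ For $N\ge1$ let $T^N_t$ ($t\in\mathbf R$) be the flow on $(\mathbf R^d)^N$ of the system $\dot z_k=\frac1N\sum_{l=1}^NK(z_k,z_l)$, $k=1,\dots,N$. Let $\mathcal P_1(\mathbf R^d)$ be the set of Borel probability measures on $\mathbf R^d$ with finite first moment, with the distance $$\operatorname{dist}_{MK,1}(\mu,\nu)=\inf_{\pi}\iint|x-y|\,\pi(dx\,dy),$$ the infimum being over all couplings $\pi$ of $\mu$ and $\nu$. Let $\mathcal P_1(\mathcal P_1(\mathbf R^d))$ be the set of Borel probability measures $P$ on the metric space $\mathcal P_1(\mathbf R^d)$ such that $\int\operatorname{dist}_{MK,1}(\mu,\delta_0)\,P(d\mu)<\infty$, with the distance $$\operatorname{Dist}_{MK,1}(P,Q)=\inf_\rho\iint\operatorname{dist}_{MK,1}(\mu,\nu)\,\rho(d\mu\,d\nu),$$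 the infimum being over all couplings $\rho$ of $P$ and $Q$. Let $$\mathcal E=\Big\{P\in\mathcal P_1(\mathcal P_1(\mathbf R^d)):\ \int_{\mathcal P_1(\mathbf R^d)}\Big(\int_{\mathbf R^d}|z|^{d+5}f(dz)\Big)P(df)<\infty\Big\}.$$ For $N\ge1$ let $\mathcal P_1((\mathbf R^d)^N/\mathfrak S_N)$ be the set of Borel probability measures on $(\mathbf R^d)^N$ with finite first moment that are invariant under all permutations of the $N$ variables; each of its elements is identified with an element of $\mathcal P_1(\mathcal P_1(\mathbf R^d))$, namely its push-forward under $(z_1,\dots,z_N)\mapsto\frac1N\sum_{k=1}^N\delta_{z_k}$. **Theorem.** There exists a unique one-parameter group $(T^\infty_t)_{t\in\mathbf R}$ of maps $\mathcal E\to\mathcal E$ (that is, $T^\infty_0=\mathrm{Id}$ and $T^\infty_{s+t}=T^\infty_s\circ T^\infty_t$ for all $s,t\in\mathbf R$) with the following properties. (a) For each $P^{in}\in\mathcal E$ and each sequence $P^{in}_N\in\mathcal P_1((\mathbf R^d)^N/\mathfrak S_N)$, $N\ge1$, such that $\operatorname{Dist}_{MK,1}(P^{in}_N,P^{in})\to0$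 as $N\to\infty$, one has $$\operatorname{Dist}_{MK,1}(T^N_t\#P^{in}_N,\,T^\infty_tP^{in})\to0\quad\text{as }N\to\infty,$$ uniformly in $t\in[-\tau,\tau]$ for each $\tau>0$. (b) For each $P^{in}\in\mathcal E$, the map $t\mapsto T^\infty_tP^{in}$ is continuous on $\mathbf R$ for the distance $\operatorname{Dist}_{MK,1}$. (c) For each $P^{in}\in\mathcal E$, the measures $P_m(t):=\int_{\mathcal P_1(\mathbf R^d)}f^{\otimes m}\,(T^\infty_tP^{in})(df)$ on $(\mathbf R^d)^m$, $m\ge1$, solve the infinite mean-field (Vlasov) hierarchy $$\partial_tP_m(t)+\sum_{k=1}^m\operatorname{div}_{z_k}\Big(\int_{\mathbf R^d}K(z_k,z_{m+1})\,P_{m+1}(t,dz_{m+1})\Big)=0,\qquad m\ge1,$$ in the sense of distributions on $\mathbf R\times(\mathbf R^d)^m$, with $P_m(0)=\int_{\mathcal P_1(\mathbf R^d)}f^{\otimes m}\,P^{in}(df)$; that is, for all $m\ge1$ and all $\varphi\in C^\infty_c(\mathbf R\times(\mathbf R^d)^m)$, all the integrals below converge and $$\int_{\mathbf R}\int_{(\mathbf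 R^d)^m}\partial_t\varphi(t,Z_m)\,P_m(t,dZ_m)\,dt+\int_{\mathbf R}\int_{(\mathbf R^d)^{m+1}}\sum_{k=1}^mK(z_k,z_{m+1})\cdot\nabla_{z_k}\varphi(t,Z_m)\,P_{m+1}(t,dZ_{m+1})\,dt=0.$$ (d) For all $P^{in},Q^{in}\in\mathcal E$ and all $t\in\mathbf R$, $$\operatorname{Dist}_{MK,1}(T^\infty_tP^{in},T^\infty_tQ^{in})\le e^{2L|t|}\operatorname{Dist}_{MK,1}(P^{in},Q^{in}).$$ -/

import Mathlib

open MeasureTheory Filter Topology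
open scoped ENNReal ContDiff

noncomputable section

/-- The one-particle phase space `ℝ^d` with its Euclidean norm. -/
abbrev Phase (d : ℕ) : Type := EuclideanSpace ℝ (Fin d)

/-! ### Monge-Kantorovich cost with exponent one -/

/-- `π` is a coupling of `μ` and `ν`: its marginals are `μ` and `ν`. -/
def IsCoupling {X : Type*} [MeasurableSpace X] (π : Measure (X × X)) (μ ν : Measure X) : Prop :=
  π.map Prod.fst = μ ∧ π.map Prod.snd = ν

/-- The infimum over all couplings `π` of `μ` and `ν` of `∫∫ c(x, y) π(dx dy)`. -/
def transportCost {X : Type*} [MeasurableSpace X] (c : X → X → ℝ≥0∞) (μ ν : Measure X) : ℝ≥0∞ :=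
  ⨅ (π : Measure (X × X)) (_ : IsCoupling π μ ν), ∫⁻ p, c p.1 p.2 ∂π

/-! ### The metric space `𝒫₁(ℝ^d)` -/

/-- `𝒫₁(ℝ^d)`: Borel probability measures on `ℝ^d` with finite first moment. -/
@[ext]
structure P1 (d : ℕ) where
  toMeasure : Measure (Phase d)
  isProbabilityMeasure : IsProbabilityMeasure toMeasure
  moment_lt_top : ∫⁻ z, ‖z‖ₑ ∂toMeasure < ⊤

/-- The distance `dist_{MK,1}` on `𝒫₁(ℝ^d)`. -/
def distMK {d : ℕ} (μ ν : P1 d) : ℝ≥0∞ :=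
  transportCost (fun x y : Phase d => edist x y) μ.toMeasure ν.toMeasure

/-- The topology of the distance `dist_{MK,1}`: a set is open when it contains
a `dist_{MK,1}`-ball around each of its points. -/
instance P1.instTopologicalSpace (d : ℕ) : TopologicalSpace (P1 d) where
  IsOpen U := ∀ μ ∈ U, ∃ ε : ℝ≥0∞, 0 < ε ∧ ∀ ν, distMK μ ν < ε → ν ∈ U
  isOpen_univ := fun _ _ => ⟨1, one_pos, fun _ _ => trivial⟩
  isOpen_inter := by
    rintro U V hU hV μ ⟨hμU, hμV⟩
    obtain ⟨ε, hε, h⟩ := hU μ hμU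
    obtain ⟨δ, hδ, h'⟩ := hV μ hμV
    exact ⟨min ε δ, lt_min hε hδ, fun ν hν =>
      ⟨h ν (hν.trans_le (min_le_left _ _)), h' ν (hν.trans_le (min_le_right _ _))⟩⟩
  isOpen_sUnion := by
    rintro S hS μ ⟨U, hU, hμ⟩
    obtain ⟨ε, hε, h⟩ := hS U hU μ hμ
    exact ⟨ε, hε, fun ν hν => ⟨U, hU, h ν hν⟩⟩

/-- `𝒫₁(ℝ^d)` carries the Borel σ-algebra of `dist_{MK,1}`. -/
instance P1.instMeasurableSpace (d : ℕ) : MeasurableSpace (P1 d) := borel (P1 d)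

instance P1.instBorelSpace (d : ℕ) : BorelSpace (P1 d) := ⟨rfl⟩

/-- The Dirac mass at `z` as an element of `𝒫₁(ℝ^d)`. -/
def P1.dirac {d : ℕ} (z : Phase d) : P1 d where
  toMeasure := Measure.dirac z
  isProbabilityMeasure := inferInstance
  moment_lt_top := by
    rw [lintegral_dirac]
    exact enorm_lt_top

/-- The empirical measure `μ_{Z_N} = (1/N) ∑ₖ δ_{z_k}` of an `N`-tuple, `N ≥ 1`. -/
def empiricalMeasure {d N : ℕ} [NeZero N] (Z : Fin N → Phase d) : P1 d where
  toMeasure := (N : ℝ≥0∞)⁻¹ • ∑ k, Measure.dirac (Z k)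
  isProbabilityMeasure := by
    constructor
    have hN : (N : ℝ≥0∞) ≠ 0 := by simpa using NeZero.ne N
    simp [ENNReal.inv_mul_cancel hN (ENNReal.natCast_ne_top N)]
  moment_lt_top := by
    have hN : (N : ℝ≥0∞) ≠ 0 := by simpa using NeZero.ne N
    rw [lintegral_smul_measure, lintegral_finsetSum_measure]
    refine ENNReal.mul_lt_top (ENNReal.inv_lt_top.2 (pos_iff_ne_zero.2 hN)) ?_
    refine ENNReal.sum_lt_top.2 fun k _ => ?_
    rw [lintegral_dirac]
    exact enorm_lt_top

/-! ### Probability measures on `𝒫₁(ℝ^d)` -/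

/-- The distance `Dist_{MK,1}` between measures on `𝒫₁(ℝ^d)`, the cost being `dist_{MK,1}`. -/
def DistMK {d : ℕ} (P Q : Measure (P1 d)) : ℝ≥0∞ :=
  transportCost distMK P Q

/-- `𝒫₁(𝒫₁(ℝ^d))`: Borel probability measures on `𝒫₁(ℝ^d)` with finite first moment. -/
def P1P1 (d : ℕ) : Set (Measure (P1 d)) :=
  {P | IsProbabilityMeasure P ∧ ∫⁻ μ, distMK μ (P1.dirac 0) ∂P < ⊤}

/-- The set `ℰ` of those `P ∈ 𝒫₁(𝒫₁(ℝ^d))` with `∫ ⟨f, |z|^(d+5)⟩ P(df) < ∞`. -/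
def setE (d : ℕ) : Set (Measure (P1 d)) :=
  {P | P ∈ P1P1 d ∧ ∫⁻ f : P1 d, (∫⁻ z, ‖z‖ₑ ^ (d + 5) ∂f.toMeasure) ∂P < ⊤}

/-! ### The `N`-particle system -/

/-- `𝒫₁((ℝ^d)^N / 𝔖_N)`: Borel probability measures on `(ℝ^d)^N` with finite first moment
that are invariant under all permutations of the `N` variables. -/
def symP1 (d N : ℕ) : Set (Measure (Fin N → Phase d)) :=
  {P | IsProbabilityMeasure P ∧ ∫⁻ Z, ∑ k, ‖Z k‖ₑ ∂P < ⊤ ∧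
    ∀ σ : Equiv.Perm (Fin N), P.map (fun Z k => Z (σ k)) = P}

/-- The element of `𝒫(𝒫₁(ℝ^d))` with which a measure on `(ℝ^d)^N` is identified: its
push-forward under `Z_N ↦ μ_{Z_N}`. -/
def empiricalLaw {d N : ℕ} [NeZero N] (P : Measure (Fin N → Phase d)) : Measure (P1 d) :=
  P.map empiricalMeasure

/-- `γ` is a global solution of `ż_k = (1/N) ∑_l K(z_k, z_l)`, `k = 1, …, N`, with `γ(0) = Z`. -/
def IsNBodySolution {d N : ℕ} (K : Phase d → Phase d → Phase d) (Z : Fin N → Phase d)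
    (γ : ℝ → Fin N → Phase d) : Prop :=
  γ 0 = Z ∧ ∀ (t : ℝ) (k : Fin N),
    HasDerivAt (fun s => γ s k) ((N : ℝ)⁻¹ • ∑ l, K (γ t k) (γ t l)) t

open Classical in
/-- The `N`-body flow `T^N_t`: the value at time `t` of the solution starting at `Z`. For a
Lipschitz continuous `K` the solution exists and is unique, for every `Z`; the second branch is
then never used. -/
def nBodyFlow {d : ℕ} (K : Phase d → Phase d → Phase d) (N : ℕ) (t : ℝ)
    (Z : Fin N → Phase d) : Fin N → Phase d :=
  if h : ∃ γ : ℝ → Fin N → Phase d, IsNBodySolution K Z γ then h.choose t else Z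

/-! ### The infinite mean-field hierarchy -/

/-- The measure `∫ f^{⊗m} P(df)` on `(ℝ^d)^m`. -/
def momentMeasure {d : ℕ} (m : ℕ) (P : Measure (P1 d)) : Measure (Fin m → Phase d) :=
  P.bind fun f => Measure.pi fun _ : Fin m => f.toMeasure

/-- `∑_{k=1}^m K(z_k, z_{m+1}) · ∇_{z_k} φ(t, z_1, …, z_m)`. -/
def hierarchyTerm {d m : ℕ} (K : Phase d → Phase d → Phase d)
    (φ : ℝ × (Fin m → Phase d) → ℝ) (t : ℝ) (Z : Fin (m + 1) → Phase d) : ℝ :=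
  ∑ k : Fin m, fderiv ℝ φ (t, fun j => Z j.castSucc)
    (0, Pi.single k (K (Z k.castSucc) (Z (Fin.last m))))

/-- `(P_m)_{m ≥ 1}` is a solution on `ℝ × (ℝ^d)^m`, in the sense of distributions, of
`∂_t P_m + ∑_{k=1}^m div_{z_k} ∫ K(z_k, z_{m+1}) P_{m+1}(t, dz_{m+1}) = 0` for all `m ≥ 1`,
with `P_m(0) = Q_m`. The integrability of all the terms is part of the definition. -/
def IsHierarchySolution {d : ℕ} (K : Phase d → Phase d → Phase d)
    (Q : ∀ m : ℕ, Measure (Fin m → Phase d))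
    (P : ∀ m : ℕ, ℝ → Measure (Fin m → Phase d)) : Prop :=
  ∀ m : ℕ, 1 ≤ m →
    P m 0 = Q m ∧
    ∀ φ : ℝ × (Fin m → Phase d) → ℝ, ContDiff ℝ ∞ φ → HasCompactSupport φ →
      (∀ t, Integrable (fun Z => fderiv ℝ φ (t, Z) (1, 0)) (P m t)) ∧
      (∀ t, Integrable (hierarchyTerm K φ t) (P (m + 1) t)) ∧
      Integrable (fun t => ∫ Z, fderiv ℝ φ (t, Z) (1, 0) ∂(P m t)) ∧
      Integrable (fun t => ∫ Z, hierarchyTerm K φ t Z ∂(P (m + 1) t)) ∧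
      (∫ t, ∫ Z, fderiv ℝ φ (t, Z) (1, 0) ∂(P m t)) +
        ∫ t, ∫ Z, hierarchyTerm K φ t Z ∂(P (m + 1) t) = 0

end

/-! The flow on `setE` is the push-forward by the Vlasov flow on `P1`: `T t P = P.map (vlasovFlow hK
t)`. The Vlasov flow sends `f` to its image under the characteristics `X_f(t, ·)`, which solve `ẋ =
∫ K(x, X_f(t, z')) f(dz')`.

Two facts give the mean-field limit. First, if `f` is an empirical measure, the integral in the
force is the N-body sum. The Vlasov flow therefore carries empirical measures along the N-body flow
(`empiricalMeasure_nBodyFlow`), and the law of the N-particle system is pushed forward by the very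
map that defines the limit. Second, there is Dobrushin's estimate (`distMK_vlasovFlow_le`). Realize
a coupling of `f` and `g` by random variables `ξ`, `η` on one space with measure `π`. The curves
`X_f(t, ξ)` and `X_g(t, η)` solve the same autonomous equation in `L¹(π)`, whose vector field is
`2L`-Lipschitz, so Gronwall's lemma gives the factor `e^{2L|t|}`. Integrating this against couplings
of `P` and `Q` gives (d), and (a) follows with uniformity on compact time intervals. The group law
is uniqueness for the `L¹` equation, and continuity in time follows from a bound on the velocities.

The characteristics are written `X(z) = z + (1 + ‖z‖) u(z)` with `u` bounded and continuous. This
yields one Lipschitz equation in a Banach space that solves for all `z` at once, continuously in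
`z`, and maps linearly into every `L¹(π)`.

For (c), differentiate `∫ φ(t, X_f(t, Z)) f^{⊗m}(dZ)` in time. The velocity of each particle is an
integral over one further independent particle, which produces `f^{⊗(m+1)}`. Averaging over `P` and
integrating in time gives the weak equation.

Uniqueness follows from (a). The symmetric measures `∫ f^{⊗N} P(df)` converge to `P` by a law of
large numbers (`tendsto_DistMK_empiricalLaw_momentMeasure`), so (a) determines `T t P` as the limit
of a fixed sequence, and such limits are unique (`eq_of_tendsto_transportCost`). -/

noncomputable section

/-! ### Transport costs -/

section Transport

variable {X Y Ω : Type*} [MeasurableSpace X] [MeasurableSpace Y] [MeasurableSpace Ω]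

theorem transportCost_le_of_isCoupling {c : X → X → ℝ≥0∞} {μ ν : Measure X}
    {π : Measure (X × X)} (h : IsCoupling π μ ν) :
    transportCost c μ ν ≤ ∫⁻ p, c p.1 p.2 ∂π :=
  iInf₂_le π h

theorem exists_isCoupling_lt {c : X → X → ℝ≥0∞} {μ ν : Measure X} {r : ℝ≥0∞}
    (h : transportCost c μ ν < r) :
    ∃ π : Measure (X × X), IsCoupling π μ ν ∧ ∫⁻ p, c p.1 p.2 ∂π < r := by
  simpa [transportCost, iInf_lt_iff] using h

/-- The joint law of `U` and `V` is a coupling. The cost need not be measurable, because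
`lintegral_map_le` is an inequality valid for every function. This allows the cost `distMK` without
joint measurability for the product σ-algebra. -/
theorem transportCost_map_le {c : X → X → ℝ≥0∞} {π : Measure Ω} {U V : Ω → X}
    (hU : Measurable U) (hV : Measurable V) :
    transportCost c (π.map U) (π.map V) ≤ ∫⁻ w, c (U w) (V w) ∂π := by
  refine (transportCost_le_of_isCoupling (π := π.map fun w => (U w, V w)) ⟨?_, ?_⟩).trans
    (lintegral_map_le _ _)
  · rw [Measure.map_map measurable_fst (hU.prodMk hV)]; rfl
  · rw [Measure.map_map measurable_snd (hU.prodMk hV)]; rfl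

theorem transportCost_comm_le {c : X → X → ℝ≥0∞} (hc : ∀ x y, c x y = c y x) (μ ν : Measure X) :
    transportCost c μ ν ≤ transportCost c ν μ := by
  refine le_iInf₂ fun π hπ => ?_
  have := transportCost_map_le (c := c) (π := π) measurable_snd measurable_fst
  rw [hπ.1, hπ.2] at this
  exact this.trans (lintegral_mono fun p => (hc _ _).le)

theorem transportCost_comm {c : X → X → ℝ≥0∞} (hc : ∀ x y, c x y = c y x) (μ ν : Measure X) :
    transportCost c μ ν = transportCost c ν μ :=
  le_antisymm (transportCost_comm_le hc μ ν) (transportCost_comm_le hc ν μ)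

theorem transportCost_self {c : X → X → ℝ≥0∞} (hc : ∀ x, c x x = 0) (μ : Measure X) :
    transportCost c μ μ = 0 := by
  have := transportCost_map_le (c := c) (π := μ) measurable_id measurable_id
  simpa [hc] using this

/-- The easy half of Kantorovich duality: integrate the pointwise inequality against an arbitrary
coupling. The restrictions on `k` permit dividing by it, which isolates the infimum. -/
theorem lintegral_le_add_transportCost {c : X → X → ℝ≥0∞} {μ ν : Measure X} {g : X → ℝ≥0∞}
    (hg : Measurable g) {k : ℝ≥0∞} (hk0 : k ≠ 0) (hk : k ≠ ⊤)
    (h : ∀ x y, g x ≤ g y + k * c x y) :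
    ∫⁻ x, g x ∂μ ≤ ∫⁻ x, g x ∂ν + k * transportCost c μ ν := by
  rw [← tsub_le_iff_left, ← ENNReal.div_le_iff' hk0 hk]
  refine le_iInf₂ fun π hπ => ?_
  rw [ENNReal.div_le_iff' hk0 hk, tsub_le_iff_left, ← hπ.1, ← hπ.2]
  rw [lintegral_map hg measurable_fst, lintegral_map hg measurable_snd,
    ← lintegral_const_mul' _ _ hk, ← lintegral_add_left (f := fun p : X × X => g p.2)
      (hg.comp measurable_snd)]
  exact lintegral_mono fun p => h p.1 p.2

open ProbabilityTheory in
/-- Couplings with a common marginal can be glued. -/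
theorem exists_gluing [StandardBorelSpace X] [Nonempty X] (π₁ π₂ : Measure (X × X))
    [IsFiniteMeasure π₁] [IsFiniteMeasure π₂] (h : π₁.map Prod.snd = π₂.map Prod.fst) :
    ∃ Γ : Measure ((X × X) × X), Γ.map Prod.fst = π₁ ∧
      Γ.map (fun q => (q.1.2, q.2)) = π₂ := by
  -- Given a pair drawn from `π₁`, draw the third point from the conditional law of `π₂` given its
  -- first coordinate, evaluated at the second point of the pair.
  refine ⟨π₁ ⊗ₘ (π₂.condKernel.comap Prod.snd measurable_snd), Measure.fst_compProd _ _, ?_⟩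
  have h2 : π₂ = π₁.map Prod.snd ⊗ₘ π₂.condKernel := by
    rw [h]; exact (π₂.disintegrate π₂.condKernel).symm
  have hm : Measurable fun q : (X × X) × X => (q.1.2, q.2) := by fun_prop
  conv_rhs => rw [h2]
  ext s hs
  rw [Measure.map_apply hm hs, Measure.compProd_apply (hm hs), Measure.compProd_apply hs,
    lintegral_map (Kernel.measurable_kernel_prodMk_left hs) measurable_snd]
  rfl

/-- Glue two almost optimal couplings along their common marginal `ν`. The standard Borel hypothesis
serves the disintegration, and the lemma is applied on `ℝ^d`. -/
theorem transportCost_triangle [StandardBorelSpace X] [Nonempty X] {c : X → X → ℝ≥0∞}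
    (hcm : Measurable fun p : X × X => c p.1 p.2) (hc : ∀ x y z, c x z ≤ c x y + c y z)
    (μ ν ρ : Measure X) [IsFiniteMeasure μ] [IsFiniteMeasure ν] :
    transportCost c μ ρ ≤ transportCost c μ ν + transportCost c ν ρ := by
  refine ENNReal.le_of_forall_pos_le_add fun ε hε hfin => ?_
  have hε2 : (ε : ℝ≥0∞) / 2 ≠ 0 := by simpa using hε.ne'
  obtain ⟨h1, h2⟩ := ENNReal.add_lt_top.1 hfin
  obtain ⟨π₁, ⟨h11, h12⟩, hπ1⟩ := exists_isCoupling_lt (ENNReal.lt_add_right h1.ne hε2)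
  obtain ⟨π₂, ⟨h21, h22⟩, hπ2⟩ := exists_isCoupling_lt (ENNReal.lt_add_right h2.ne hε2)
  have i1 : IsFiniteMeasure π₁ := by
    constructor
    have := measure_lt_top μ Set.univ
    rwa [← h11, Measure.map_apply measurable_fst MeasurableSet.univ, Set.preimage_univ] at this
  have i2 : IsFiniteMeasure π₂ := by
    constructor
    have := measure_lt_top ν Set.univ
    rwa [← h21, Measure.map_apply measurable_fst MeasurableSet.univ, Set.preimage_univ] at this
  obtain ⟨Γ, hΓ1, hΓ2⟩ := exists_gluing π₁ π₂ (h12.trans h21.symm)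
  have hm : Measurable fun q : (X × X) × X => (q.1.2, q.2) := by fun_prop
  have e1 : Γ.map (fun q => q.1.1) = μ := by
    rw [← h11, ← hΓ1, Measure.map_map measurable_fst measurable_fst]; rfl
  have e2 : Γ.map (fun q => q.2) = ρ := by
    rw [← h22, ← hΓ2, Measure.map_map measurable_snd hm]; rfl
  calc transportCost c μ ρ ≤ ∫⁻ q, c q.1.1 q.2 ∂Γ := by
        rw [← e1, ← e2]; 
        exact transportCost_map_le (measurable_fst.comp measurable_fst) measurable_snd
    _ ≤ ∫⁻ q, (c q.1.1 q.1.2 + c q.1.2 q.2) ∂Γ := lintegral_mono fun q => hc _ _ _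
    _ = ∫⁻ p, c p.1 p.2 ∂π₁ + ∫⁻ p, c p.1 p.2 ∂π₂ := by
        rw [lintegral_add_left (f := fun q : (X × X) × X => c q.1.1 q.1.2)
          (hcm.comp measurable_fst), ← hΓ1, ← hΓ2,
          lintegral_map hcm measurable_fst, lintegral_map hcm hm]
    _ ≤ (transportCost c μ ν + ε / 2) + (transportCost c ν ρ + ε / 2) := by gcongr
    _ = transportCost c μ ν + transportCost c ν ρ + ε := by
        rw [add_add_add_comm, ENNReal.add_halves]

theorem LipschitzWith.coe_le_add_edist {X : Type*} [PseudoEMetricSpace X] {g : X → NNReal}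
    {k : NNReal} (hg : LipschitzWith k g) (x y : X) :
    (g x : ℝ≥0∞) ≤ g y + k * edist x y := by
  have h1 : (g x : ℝ≥0∞) ≤ g y + edist (g x) (g y) := by
    rw [edist_nndist]
    exact_mod_cast NNReal.le_add_nndist (g x) (g y)
  exact h1.trans (by gcongr; exact hg x y)

/-- Two finite measures which are both limits, for a transport cost, of the same sequence of
measures are equal. -/
theorem eq_of_tendsto_transportCost {X : Type*} [PseudoEMetricSpace X] [MeasurableSpace X]
    [BorelSpace X] {A B : Measure X} [IsProbabilityMeasure A] [IsProbabilityMeasure B]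
    {R : ℕ → Measure X}
    (hA : Tendsto (fun n => transportCost (fun x y : X => edist x y) (R n) A) atTop (𝓝 0))
    (hB : Tendsto (fun n => transportCost (fun x y : X => edist x y) (R n) B) atTop (𝓝 0)) :
    A = B := by
  -- Lipschitz observables are compared through `R n`: the two transport costs bound the error, so
  -- no triangle inequality or gluing is needed on `X`.
  have key : ∀ A B : Measure X,
      Tendsto (fun n => transportCost (fun x y : X => edist x y) (R n) A) atTop (𝓝 0) →
      Tendsto (fun n => transportCost (fun x y : X => edist x y) (R n) B) atTop (𝓝 0) →
      ∀ (g : X → NNReal) (k : NNReal), LipschitzWith k g → ∫⁻ x, g x ∂A ≤ ∫⁻ x, g x ∂B := by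
    intro A B hA hB g k hg
    have hgm : Measurable fun x => (g x : ℝ≥0∞) := hg.continuous.measurable.coe_nnreal_ennreal
    -- The constant `k + 1` replaces `k` because `lintegral_le_add_transportCost` needs a nonzero
    -- one.
    have hgl : ∀ x y, (g x : ℝ≥0∞) ≤ g y + (k + 1) * edist x y := fun x y =>
      (hg.coe_le_add_edist x y).trans (by gcongr; exact le_self_add)
    have hk : (k : ℝ≥0∞) + 1 ≠ ⊤ := by finiteness
    have hlim := (tendsto_const_nhds (x := ∫⁻ x, (g x : ℝ≥0∞) ∂B)).add
      ((ENNReal.Tendsto.const_mul hB (Or.inr hk)).add (ENNReal.Tendsto.const_mul hA (Or.inr hk)))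
    simp only [mul_zero, add_zero] at hlim
    refine ge_of_tendsto hlim (Eventually.of_forall fun n => ?_)
    have s1 := lintegral_le_add_transportCost (μ := A) (ν := R n) hgm (by simp) hk hgl
    have s2 := lintegral_le_add_transportCost (μ := R n) (ν := B) hgm (by simp) hk hgl
    rw [transportCost_comm fun x y => edist_comm x y] at s1
    rw [← add_assoc]
    exact s1.trans (by gcongr)
  have hg : ∀ (g : X → NNReal) (k : NNReal), LipschitzWith k g →
      ∫⁻ x, g x ∂A = ∫⁻ x, g x ∂B := fun g k h =>
    le_antisymm (key A B hA hB g k h) (key B A hB hA g k h)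
  -- Closed sets generate the Borel σ-algebra, and their indicators are limits of the Lipschitz
  -- functions `thickenedIndicator`.
  refine ext_of_generate_finite _ ?_ isPiSystem_isClosed ?_ (by simp)
  · rw [← borel_eq_generateFrom_isClosed]; exact BorelSpace.measurable_eq
  intro F hF
  have hpos : ∀ n : ℕ, (0 : ℝ) < 1 / (n + 1) := fun n => Nat.one_div_pos_of_nat
  have hA' := tendsto_lintegral_thickenedIndicator_of_isClosed A hF hpos
    tendsto_one_div_add_atTop_nhds_zero_nat
  have hB' := tendsto_lintegral_thickenedIndicator_of_isClosed B hF hpos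
    tendsto_one_div_add_atTop_nhds_zero_nat
  refine tendsto_nhds_unique hA' (hB'.congr fun n => ?_)
  exact (hg _ _ (lipschitzWith_thickenedIndicator (hpos n) F)).symm

end Transport

/-! ### The metric space `𝒫₁(ℝ^d)` -/

section MetricP1

variable {d : ℕ}

instance P1.instIsProbabilityMeasure (f : P1 d) : IsProbabilityMeasure f.toMeasure :=
  f.isProbabilityMeasure

theorem distMK_comm (μ ν : P1 d) : distMK μ ν = distMK ν μ :=
  transportCost_comm (fun x y => edist_comm x y) _ _

theorem distMK_self (μ : P1 d) : distMK μ μ = 0 :=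
  transportCost_self (fun x => edist_self x) _

theorem distMK_triangle (μ ν ρ : P1 d) : distMK μ ρ ≤ distMK μ ν + distMK ν ρ :=
  transportCost_triangle (by fun_prop) (fun x y z => edist_triangle x y z) _ _ _

/-- `dist_{MK,1}` as an extended pseudo-distance inducing the topology of `𝒫₁(ℝ^d)`. -/
instance P1.instPseudoEMetricSpace : PseudoEMetricSpace (P1 d) :=
  let m : PseudoEMetricSpace (P1 d) :=
    { edist := distMK
      edist_self := distMK_self
      edist_comm := distMK_comm
      edist_triangle := distMK_triangle }
  { edist := distMK
    edist_self := distMK_self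
    edist_comm := distMK_comm
    edist_triangle := distMK_triangle
    -- The topology is replaced by the one already declared on `P1 d`, so that the Borel structure
    -- refers to the same topology.
    toUniformSpace := m.toUniformSpace.replaceTopology (by
      refine TopologicalSpace.ext_iff.2 fun s => ?_
      rw [@EMetric.isOpen_iff _ m]
      refine forall₂_congr fun μ _ => exists_congr fun ε => and_congr_right fun _ => ?_
      refine forall_congr' fun ν => ?_
      rw [distMK_comm]
      rfl)
    uniformity_edist := m.uniformity_edist }

theorem continuous_lintegral_toMeasure {g : Phase d → NNReal} {k : NNReal}
    (hg : LipschitzWith k g) :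
    Continuous fun f : P1 d => ∫⁻ x, (g x : ℝ≥0∞) ∂f.toMeasure := by
  refine continuous_of_le_add_edist (k + 1) (by finiteness) fun μ ν => ?_
  exact lintegral_le_add_transportCost hg.continuous.measurable.coe_nnreal_ennreal
    (by simp) (by finiteness)
    fun x y => (hg.coe_le_add_edist x y).trans (by gcongr; exact le_self_add)

/-- The mass of a closed set is a limit of integrals of Lipschitz functions, which are continuous in
`f`. This makes `f ↦ f^{⊗m}` a kernel on the Borel space `P1 d`. -/
theorem measurable_toMeasure : Measurable (P1.toMeasure : P1 d → Measure (Phase d)) := by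
  refine .measure_of_isPiSystem_of_isProbabilityMeasure
    (by rw [← borel_eq_generateFrom_isClosed]; exact BorelSpace.measurable_eq)
    isPiSystem_isClosed fun F hF => ?_
  have hpos : ∀ n : ℕ, (0 : ℝ) < 1 / (n + 1) := fun n => Nat.one_div_pos_of_nat
  refine measurable_of_tendsto_metrizable
    (f := fun (n : ℕ) (f : P1 d) => ∫⁻ x, thickenedIndicator (hpos n) F x ∂f.toMeasure)
    (fun n => (continuous_lintegral_toMeasure
      (lipschitzWith_thickenedIndicator (hpos n) F)).measurable) ?_
  exact tendsto_pi_nhds.2 fun f => tendsto_lintegral_thickenedIndicator_of_isClosed _ hF hpos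
    tendsto_one_div_add_atTop_nhds_zero_nat

theorem measurable_pi_toMeasure (m : ℕ) :
    Measurable fun f : P1 d => Measure.pi fun _ : Fin m => f.toMeasure := by
  refine .measure_of_isPiSystem_of_isProbabilityMeasure generateFrom_pi.symm isPiSystem_pi ?_
  rintro _ ⟨s, hs, rfl⟩
  simp only [Measure.pi_pi]
  exact Finset.measurable_prod _ fun i _ =>
    (Measure.measurable_coe (by simpa using hs i (Set.mem_univ i))).comp measurable_toMeasure

/-- The Markov kernel `f ↦ f^{⊗m}`. -/
def piKernel (d m : ℕ) : ProbabilityTheory.Kernel (P1 d) (Fin m → Phase d) where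
  toFun f := Measure.pi fun _ : Fin m => f.toMeasure
  measurable' := measurable_pi_toMeasure m

theorem piKernel_apply (m : ℕ) (f : P1 d) :
    piKernel d m f = Measure.pi fun _ : Fin m => f.toMeasure := rfl

instance (m : ℕ) : ProbabilityTheory.IsMarkovKernel (piKernel d m) :=
  ⟨fun f => by rw [piKernel_apply]; infer_instance⟩

/-- The upper bound couples `z` with `0`; the lower bound tests with the 1-Lipschitz function `‖z‖`.
The moment condition in `P1P1` thus becomes integrability of the first moment. -/
theorem distMK_dirac_zero (f : P1 d) : distMK f (P1.dirac 0) = ∫⁻ z, ‖z‖ₑ ∂f.toMeasure := by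
  apply le_antisymm
  · have h := transportCost_map_le (c := fun x y : Phase d => edist x y) (π := f.toMeasure)
      measurable_id (measurable_const (a := (0 : Phase d)))
    simpa [Measure.map_const, edist_zero_right, distMK, P1.dirac] using h
  · have h := lintegral_le_add_transportCost (c := fun x y : Phase d => edist x y)
      (μ := f.toMeasure) (ν := Measure.dirac 0) (g := fun z => ‖z‖ₑ) (by fun_prop)
      one_ne_zero ENNReal.one_ne_top fun x y => by
        rw [one_mul, ← edist_zero_right, ← edist_zero_right, add_comm]
        exact edist_triangle x y 0
    simpa [distMK, P1.dirac] using h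

/-- The first moment of `f`. -/
def P1.moment (f : P1 d) : ℝ := ∫ z, ‖z‖ ∂f.toMeasure

theorem P1.integrable_id (f : P1 d) : Integrable (fun z : Phase d => z) f.toMeasure :=
  ⟨by fun_prop, f.moment_lt_top⟩

theorem P1.moment_nonneg (f : P1 d) : 0 ≤ f.moment := integral_nonneg fun _ => norm_nonneg _

theorem P1.ofReal_moment (f : P1 d) : ENNReal.ofReal f.moment = ∫⁻ z, ‖z‖ₑ ∂f.toMeasure :=
  ofReal_integral_norm_eq_lintegral_enorm f.integrable_id

theorem P1.measurable_moment : Measurable (P1.moment : P1 d → ℝ) := by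
  have : (P1.moment : P1 d → ℝ) = fun f => (∫⁻ z, ‖z‖ₑ ∂f.toMeasure).toReal := by
    funext f
    rw [← f.ofReal_moment, ENNReal.toReal_ofReal f.moment_nonneg]
  rw [this]
  exact ((Measure.measurable_lintegral (by fun_prop)).comp measurable_toMeasure).ennreal_toReal

theorem P1.integrable_moment {P : Measure (P1 d)} (hP : P ∈ P1P1 d) : Integrable P1.moment P := by
  refine ⟨P1.measurable_moment.aestronglyMeasurable, ?_⟩
  refine lt_of_eq_of_lt (lintegral_congr fun f => ?_) hP.2
  rw [distMK_dirac_zero, ← f.ofReal_moment, Real.enorm_of_nonneg f.moment_nonneg]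

/-- The push-forward of a probability measure by an integrable map, as an element of `𝒫₁`. -/
def P1.law {Ω : Type*} [MeasurableSpace Ω] (π : Measure Ω) [IsProbabilityMeasure π]
    (X : Ω → Phase d) (hX : Measurable X) (hXi : Integrable X π) : P1 d where
  toMeasure := π.map X
  isProbabilityMeasure := Measure.isProbabilityMeasure_map hX.aemeasurable
  moment_lt_top := by
    rw [lintegral_map (by fun_prop) hX]
    exact hXi.2

end MetricP1

/-! ### Global solutions of autonomous Lipschitz differential equations -/

section ODE

variable {E : Type*} [NormedAddCommGroup E] [NormedSpace ℝ E]

/-- In the weight `e^{c|t|}`, taking a primitive gains the factor `1 / c`. This turns the Picard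
operator into a global contraction. Negative times reduce to positive ones by reflection. -/
theorem norm_integral_le_of_norm_le_exp {φ : ℝ → E} {A c : ℝ} (hc : 0 < c)
    (h : ∀ s, ‖φ s‖ ≤ A * Real.exp (c * |s|)) (t : ℝ) :
    ‖∫ s in (0 : ℝ)..t, φ s‖ ≤ A / c * Real.exp (c * |t|) := by
  have hA : 0 ≤ A := by simpa using (norm_nonneg _).trans (h 0)
  have key : ∀ ψ : ℝ → E, (∀ s, ‖ψ s‖ ≤ A * Real.exp (c * |s|)) → ∀ t, 0 ≤ t →
      ‖∫ s in (0 : ℝ)..t, ψ s‖ ≤ A / c * Real.exp (c * |t|) := by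
    intro ψ hψ t ht
    have h1 : ‖∫ s in (0 : ℝ)..t, ψ s‖ ≤ ∫ s in (0 : ℝ)..t, A * Real.exp (c * s) := by
      refine intervalIntegral.norm_integral_le_of_norm_le ht ?_
        ((by fun_prop : Continuous fun s => A * Real.exp (c * s)).intervalIntegrable _ _)
      refine Eventually.of_forall fun s hs => ?_
      simpa [abs_of_pos hs.1] using hψ s
    have h2 : ∫ s in (0 : ℝ)..t, A * Real.exp (c * s) = A / c * (Real.exp (c * t) - 1) := by
      rw [intervalIntegral.integral_const_mul, intervalIntegral.integral_comp_mul_left _ hc.ne']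
      simp
      ring
    rw [abs_of_nonneg ht]
    refine (h1.trans h2.le).trans ?_
    gcongr
    linarith
  rcases le_total 0 t with ht | ht
  · exact key φ h t ht
  · have := key (fun s => φ (-s)) (fun s => by simpa using h (-s)) (-t) (by linarith)
    rw [intervalIntegral.integral_comp_neg, intervalIntegral.integral_symm] at this
    simpa using this

/-- Picard iteration on all of `ℝ` at once, in a sup norm with exponential weight. The unknown is `w
= e^{-2k|t|} γ`, which is bounded and continuous, and the weight exponent `2k` makes the contraction
factor `k / (2k) = 1/2`. -/
theorem LipschitzWith.exists_global_solution [CompleteSpace E] {F : E → E} {K : NNReal}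
    (hF : LipschitzWith K F) (x₀ : E) :
    ∃ γ : ℝ → E, γ 0 = x₀ ∧ ∀ t, HasDerivAt γ (F (γ t)) t := by
  -- Adding one keeps `k` positive even when `K = 0`, so that `2 * k` can be divided by.
  set k : ℝ := K + 1 with hk
  have hk0 : 0 < k := by positivity
  have hF' : ∀ x y, ‖F x - F y‖ ≤ k * ‖x - y‖ := fun x y => by
    have := hF.dist_le_mul x y
    rw [dist_eq_norm, dist_eq_norm] at this
    refine this.trans ?_
    gcongr
    linarith
  let e : ℝ → ℝ := fun t => Real.exp (2 * k * |t|)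
  have he1 : ∀ t, 1 ≤ e t := fun t => Real.one_le_exp (by positivity)
  have hec : Continuous e := by fun_prop
  let G : BoundedContinuousFunction ℝ E → ℝ → E := fun w t =>
    (e t)⁻¹ • (x₀ + ∫ s in (0 : ℝ)..t, F (e s • w s))
  have hint : ∀ w : BoundedContinuousFunction ℝ E, Continuous fun s => F (e s • w s) := fun w =>
    hF.continuous.comp (hec.smul w.continuous)
  have hinv : ∀ t, 0 < (e t)⁻¹ := fun t => inv_pos.2 (one_pos.trans_le (he1 t))
  have hGc : ∀ w, Continuous (G w) := fun w =>
    (hec.inv₀ fun t => (one_pos.trans_le (he1 t)).ne').smul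
      (continuous_const.add (intervalIntegral.continuous_primitive
        (fun a b => (hint w).intervalIntegrable a b) 0))
  have hGb : ∀ (w : BoundedContinuousFunction ℝ E) t,
      ‖G w t‖ ≤ ‖x₀‖ + (‖F 0‖ + k * ‖w‖) / (2 * k) := by
    intro w t
    have hb : ∀ s, ‖F (e s • w s)‖ ≤ (‖F 0‖ + k * ‖w‖) * Real.exp (2 * k * |s|) := by
      intro s
      have h1 := hF' (e s • w s) 0
      rw [sub_zero, norm_smul, Real.norm_of_nonneg (zero_le_one.trans (he1 s))] at h1
      have h2 : ‖F (e s • w s)‖ ≤ ‖F 0‖ + ‖F (e s • w s) - F 0‖ := norm_le_insert' _ _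
      have h3 : k * (e s * ‖w s‖) ≤ k * (e s * ‖w‖) := by
        have := w.norm_coe_le_norm s
        have := he1 s
        gcongr
      have h4 : ‖F 0‖ ≤ ‖F 0‖ * e s := le_mul_of_one_le_right (norm_nonneg _) (he1 s)
      change _ ≤ (‖F 0‖ + k * ‖w‖) * e s
      linarith
    have h1 := norm_integral_le_of_norm_le_exp (by positivity) hb t
    have h2 : ‖x₀‖ ≤ ‖x₀‖ * e t := le_mul_of_one_le_right (norm_nonneg _) (he1 t)
    rw [norm_smul, Real.norm_of_nonneg (hinv t).le, inv_mul_le_iff₀ (one_pos.trans_le (he1 t))]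
    refine (norm_add_le _ _).trans ?_
    change _ ≤ e t * _
    change _ ≤ _ * e t at h1
    linarith
  let Φ : BoundedContinuousFunction ℝ E → BoundedContinuousFunction ℝ E := fun w =>
    BoundedContinuousFunction.ofNormedAddCommGroup (G w) (hGc w) _ (hGb w)
  have hΦ : ContractingWith (1 / 2) Φ := by
    refine ⟨by rw [← NNReal.coe_lt_coe]; norm_num, LipschitzWith.of_dist_le_mul fun w w' => ?_⟩
    refine (BoundedContinuousFunction.dist_le (by positivity)).2 fun t => ?_
    have hb : ∀ s, ‖F (e s • w s) - F (e s • w' s)‖ ≤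
        (k * dist w w') * Real.exp (2 * k * |s|) := by
      intro s
      refine (hF' _ _).trans ?_
      rw [← smul_sub, norm_smul, Real.norm_of_nonneg (zero_le_one.trans (he1 s)), ← dist_eq_norm]
      have := BoundedContinuousFunction.dist_coe_le_dist (f := w) (g := w') s
      have h0 := zero_le_one.trans (he1 s)
      calc k * (e s * dist (w s) (w' s)) ≤ k * (e s * dist w w') := by gcongr
        _ = _ := by simp only [e]; ring
    have h1 := norm_integral_le_of_norm_le_exp (by positivity) hb t
    rw [intervalIntegral.integral_sub ((hint w).intervalIntegrable _ _)
      ((hint w').intervalIntegrable _ _)] at h1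
    change dist (G w t) (G w' t) ≤ _
    rw [dist_eq_norm, ← smul_sub, norm_smul, Real.norm_of_nonneg (hinv t).le,
      add_sub_add_left_eq_sub, inv_mul_le_iff₀ (one_pos.trans_le (he1 t))]
    refine h1.trans (le_of_eq ?_)
    simp only [e]
    push_cast
    field_simp
  obtain ⟨w, hw⟩ : ∃ w, Φ w = w := ⟨_, hΦ.fixedPoint_isFixedPt⟩
  have hγ : ∀ t, e t • w t = x₀ + ∫ s in (0 : ℝ)..t, F (e s • w s) := by
    intro t
    have h : G w t = w t := congrArg (fun u : BoundedContinuousFunction ℝ E => u t) hw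
    rw [← h, smul_smul, mul_inv_cancel₀ (one_pos.trans_le (he1 t)).ne', one_smul]
  refine ⟨fun t => e t • w t, by simpa using hγ 0, fun t => ?_⟩
  have h := ((hint w).integral_hasStrictDerivAt 0 t).hasDerivAt.const_add x₀
  exact h.congr_of_eventuallyEq (Eventually.of_forall hγ)

theorem dist_le_of_global_solutions {F : E → E} {K : NNReal} (hF : LipschitzWith K F)
    {x y : ℝ → E} (hx : ∀ t, HasDerivAt x (F (x t)) t) (hy : ∀ t, HasDerivAt y (F (y t)) t)
    (t : ℝ) : dist (x t) (y t) ≤ Real.exp (K * |t|) * dist (x 0) (y 0) := by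
  have key : ∀ (G : E → E), LipschitzWith K G → ∀ x y : ℝ → E,
      (∀ t, HasDerivAt x (G (x t)) t) → (∀ t, HasDerivAt y (G (y t)) t) → ∀ t, 0 ≤ t →
      dist (x t) (y t) ≤ Real.exp (K * |t|) * dist (x 0) (y 0) := by
    intro G hG x y hx hy t ht
    have := dist_le_of_trajectories_ODE (v := fun _ => G) (fun _ => hG)
      (fun s _ => (hx s).continuousAt.continuousWithinAt) (fun s _ => (hx s).hasDerivWithinAt)
      (fun s _ => (hy s).continuousAt.continuousWithinAt) (fun s _ => (hy s).hasDerivWithinAt)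
      le_rfl t ⟨ht, le_rfl⟩
    rw [abs_of_nonneg ht]
    rwa [sub_zero, mul_comm] at this
  rcases le_total 0 t with ht | ht
  · exact key F hF x y hx hy t ht
  -- Backward in time, the reversed curves solve the equation of `-F`, which has the same Lipschitz
  -- constant.
  · have hn : ∀ {x : ℝ → E}, (∀ t, HasDerivAt x (F (x t)) t) →
        ∀ t, HasDerivAt (fun s => x (-s)) (-F (x (-t))) t := fun hx t => by
      simpa [Function.comp_def] using (hx (-t)).scomp t (hasDerivAt_neg t)
    have := key (fun z => -F z) hF.neg (fun s => x (-s)) (fun s => y (-s)) (hn hx) (hn hy) (-t)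
      (by linarith)
    simpa using this

end ODE

/-! ### Mean-field interactions -/

/-- `K` is `L`-Lipschitz in each variable and vanishes on the diagonal, at least in the quantified
form `‖K z z'‖ ≤ L * (‖z‖ + ‖z'‖)`. -/
structure IsLipschitzKernel {d : ℕ} (K : Phase d → Phase d → Phase d) (L : NNReal) : Prop where
  lip₁ : ∀ z₁ z₂ z', ‖K z₁ z' - K z₂ z'‖ ≤ L * ‖z₁ - z₂‖
  lip₂ : ∀ z z₁ z₂, ‖K z z₁ - K z z₂‖ ≤ L * ‖z₁ - z₂‖
  norm_le : ∀ z z', ‖K z z'‖ ≤ L * (‖z‖ + ‖z'‖)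

/-- The force `∫ K(x, X(w)) π(dw)` exerted at `x` by particles distributed like `X`. -/
def interaction {d : ℕ} {Ω : Type*} [MeasurableSpace Ω] (K : Phase d → Phase d → Phase d)
    (π : Measure Ω) (X : Ω → Phase d) (x : Phase d) : Phase d :=
  ∫ w, K x (X w) ∂π

section Interaction

variable {d : ℕ} {Ω : Type*} [MeasurableSpace Ω] {K : Phase d → Phase d → Phase d} {L : NNReal}
  {π : Measure Ω} [IsProbabilityMeasure π] {X Y : Ω → Phase d}

namespace IsLipschitzKernel

variable (hK : IsLipschitzKernel K L)
include hK

theorem norm_sub_le (a b a' b' : Phase d) :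
    ‖K a b - K a' b'‖ ≤ L * ‖a - a'‖ + L * ‖b - b'‖ := by
  rw [← sub_add_sub_cancel (K a b) (K a' b)]
  exact (norm_add_le _ _).trans (add_le_add (hK.lip₁ _ _ _) (hK.lip₂ _ _ _))

theorem continuous_uncurry : Continuous fun p : Phase d × Phase d => K p.1 p.2 := by
  refine (LipschitzWith.of_dist_le_mul (K := L + L) fun p q => ?_).continuous
  rw [dist_eq_norm]
  refine (hK.norm_sub_le _ _ _ _).trans ?_
  rw [dist_eq_norm]
  push_cast
  rw [add_mul]
  gcongr
  · exact norm_fst_le (p - q)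
  · exact norm_snd_le (p - q)

theorem integrable (hX : Integrable X π) (x : Phase d) : Integrable (fun w => K x (X w)) π := by
  refine Integrable.mono' ((integrable_const ‖x‖).add hX.norm |>.const_mul (L : ℝ)) ?_
    (Eventually.of_forall fun w => hK.norm_le _ _)
  exact (hK.continuous_uncurry.comp (by fun_prop : Continuous fun z : Phase d => (x, z)))
    |>.comp_aestronglyMeasurable hX.1

/-- `X` and `Y` live on the same probability space, so their forces are compared sample by sample. A
coupling enters the force only through the `L¹` distance. -/
theorem norm_interaction_sub_le (hX : Integrable X π) (hY : Integrable Y π) (x y : Phase d) :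
    ‖interaction K π X x - interaction K π Y y‖ ≤ L * ‖x - y‖ + L * ∫ w, ‖X w - Y w‖ ∂π := by
  rw [interaction, interaction, ← integral_sub (hK.integrable hX x) (hK.integrable hY y)]
  have hi : Integrable (fun w => L * ‖x - y‖ + L * ‖X w - Y w‖) π :=
    (integrable_const _).add ((hX.sub hY).norm.const_mul _)
  refine (norm_integral_le_of_norm_le hi
    (Eventually.of_forall fun w => hK.norm_sub_le _ _ _ _)).trans (le_of_eq ?_)
  have hn : Integrable (fun w => ‖X w - Y w‖) π := (hX.sub hY).norm
  rw [integral_add (integrable_const _) (hn.const_mul _)]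
  simp [integral_const_mul]

theorem norm_interaction_le (hX : Integrable X π) (x : Phase d) :
    ‖interaction K π X x‖ ≤ L * (‖x‖ + ∫ w, ‖X w‖ ∂π) := by
  have hi : Integrable (fun w => L * (‖x‖ + ‖X w‖)) π :=
    ((integrable_const _).add hX.norm).const_mul _
  refine (norm_integral_le_of_norm_le hi
    (Eventually.of_forall fun w => hK.norm_le _ _)).trans (le_of_eq ?_)
  rw [integral_const_mul, integral_add (integrable_const _) hX.norm]
  simp

theorem continuous_interaction (hX : Integrable X π) : Continuous (interaction K π X) := by
  refine (LipschitzWith.of_dist_le_mul (K := L) fun x y => ?_).continuous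
  simpa [dist_eq_norm] using hK.norm_interaction_sub_le hX hX x y

theorem integrable_interaction (hX : Integrable X π) (hY : Integrable Y π) :
    Integrable (fun w => interaction K π X (Y w)) π := by
  refine Integrable.mono' ((hY.norm.add (integrable_const (∫ w, ‖X w‖ ∂π))).const_mul (L : ℝ)) ?_
    (Eventually.of_forall fun w => hK.norm_interaction_le hX _)
  exact (hK.continuous_interaction hX).comp_aestronglyMeasurable hY.1

end IsLipschitzKernel

/-- The mean-field vector field on `L¹(π)`: `X ↦ (w ↦ ∫ K(X(w), X(w')) π(dw'))`. -/
def lagrangianField (hK : IsLipschitzKernel K L) (π : Measure Ω) [IsProbabilityMeasure π]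
    (x : Lp (Phase d) 1 π) : Lp (Phase d) 1 π :=
  (hK.integrable_interaction (L1.integrable_coeFn x) (L1.integrable_coeFn x)).toL1
    (fun w => interaction K π x (x w))

omit [IsProbabilityMeasure π] in
theorem interaction_congr (h : X =ᵐ[π] Y) (x : Phase d) :
    interaction K π X x = interaction K π Y x :=
  integral_congr_ae (h.mono fun w hw => by simp only [hw])

theorem lagrangianField_toL1 (hK : IsLipschitzKernel K L) (hX : Integrable X π) :
    lagrangianField hK π (hX.toL1 X) =
      (hK.integrable_interaction hX hX).toL1 (fun w => interaction K π X (X w)) := by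
  refine (Integrable.toL1_eq_toL1_iff _ _ _ _).2 ?_
  filter_upwards [hX.coeFn_toL1] with w hw
  rw [hw, interaction_congr hX.coeFn_toL1]

/-- One `L` comes from the position where the force is felt, the other from the distribution
exerting it. This is the origin of the rate `e^{2L|t|}`. -/
theorem lipschitzWith_lagrangianField (hK : IsLipschitzKernel K L) :
    LipschitzWith (2 * L) (lagrangianField hK π) := by
  refine LipschitzWith.of_dist_le_mul fun x y => ?_
  have hx := L1.integrable_coeFn x
  have hy := L1.integrable_coeFn y
  rw [← Integrable.toL1_coeFn x hx, ← Integrable.toL1_coeFn y hy, lagrangianField_toL1,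
    lagrangianField_toL1, dist_eq_norm, dist_eq_norm, ← Integrable.toL1_sub, ← Integrable.toL1_sub,
    L1.norm_of_fun_eq_integral_norm, L1.norm_of_fun_eq_integral_norm]
  have hxy : Integrable (fun w => ‖x w - y w‖) π := (hx.sub hy).norm
  calc ∫ w, ‖interaction K π x (x w) - interaction K π y (y w)‖ ∂π
      ≤ ∫ w, (L * ‖x w - y w‖ + L * ∫ w, ‖x w - y w‖ ∂π) ∂π := by
        refine integral_mono
          ((hK.integrable_interaction hx hx).sub (hK.integrable_interaction hy hy)).norm
          ((hxy.const_mul _).add (integrable_const _)) fun w => ?_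
        exact hK.norm_interaction_sub_le hx hy _ _
    _ = _ := by
        rw [integral_add (hxy.const_mul _) (integrable_const _), integral_const_mul]
        simp only [integral_const, probReal_univ, one_smul, Pi.sub_apply]
        push_cast
        ring

/-- Since `K 0 0 = 0`, the zero map is a stationary solution. Comparing with it bounds the growth of
first moments without an additive constant. -/
theorem lagrangianField_zero (hK : IsLipschitzKernel K L) : lagrangianField hK π 0 = 0 := by
  have h0 : K 0 0 = 0 := by simpa using hK.norm_le 0 0
  have h := lagrangianField_toL1 hK (integrable_zero Ω (Phase d) π)
  rw [Integrable.toL1_zero] at h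
  rw [h]
  refine (Integrable.toL1_eq_toL1_iff _ 0 _ (integrable_zero Ω (Phase d) π)).2
    (Eventually.of_forall fun w => ?_)
  simp [interaction, h0]

end Interaction

/-! ### The characteristics of the Vlasov equation -/

section Characteristics

open scoped BoundedContinuousFunction

variable {d : ℕ} {Ω : Type*} [MeasurableSpace Ω] {K : Phase d → Phase d → Phase d} {L : NNReal}
  {π : Measure Ω} [IsProbabilityMeasure π] {ξ : Ω → Phase d}

/-- The map `z ↦ z + (1 + ‖z‖) u(z)`. -/
def displace (u : Phase d →ᵇ Phase d) (z : Phase d) : Phase d := z + (1 + ‖z‖) • u z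

theorem continuous_displace (u : Phase d →ᵇ Phase d) : Continuous (displace u) := by
  unfold displace; fun_prop

theorem integrable_weight_smul (hξ : Measurable ξ) (hi : Integrable ξ π) (u : Phase d →ᵇ Phase d) :
    Integrable (fun w => (1 + ‖ξ w‖) • u (ξ w)) π := by
  refine Integrable.mono' (((integrable_const (1 : ℝ)).add hi.norm).mul_const ‖u‖) ?_
    (Eventually.of_forall fun w => ?_)
  · exact (by fun_prop : Continuous fun z : Phase d => (1 + ‖z‖) • u z).comp_aestronglyMeasurable
      hξ.aestronglyMeasurable
  · rw [norm_smul, Real.norm_of_nonneg (by positivity)]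
    simp only [Pi.add_apply]
    gcongr
    exact u.norm_coe_le_norm _

theorem integrable_displace (hξ : Measurable ξ) (hi : Integrable ξ π) (u : Phase d →ᵇ Phase d) :
    Integrable (fun w => displace u (ξ w)) π :=
  hi.add (integrable_weight_smul hξ hi u)

/-- The bounded linear map `u ↦ (w ↦ (1 + ‖ξ(w)‖) u(ξ(w)))` into `L¹(π)`. -/
def weightedComp (π : Measure Ω) [IsProbabilityMeasure π] (hξ : Measurable ξ)
    (hi : Integrable ξ π) : (Phase d →ᵇ Phase d) →L[ℝ] Lp (Phase d) 1 π :=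
  LinearMap.mkContinuous
    { toFun := fun u => (integrable_weight_smul hξ hi u).toL1 (fun w => (1 + ‖ξ w‖) • u (ξ w))
      map_add' := fun u v => by
        rw [← Integrable.toL1_add]
        congr 1
        funext w
        simp
      map_smul' := fun c u => by
        rw [RingHom.id_apply, ← Integrable.toL1_smul]
        congr 1
        funext w
        simp [smul_comm c] }
    (∫ w, (1 + ‖ξ w‖) ∂π) (fun u => by
      simp only [LinearMap.coe_mk, AddHom.coe_mk]
      rw [L1.norm_of_fun_eq_integral_norm, ← integral_mul_const]
      refine integral_mono (integrable_weight_smul hξ hi u).norm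
        (((integrable_const (1 : ℝ)).add hi.norm).mul_const ‖u‖) fun w => ?_
      rw [norm_smul, Real.norm_of_nonneg (by positivity)]
      gcongr
      exact u.norm_coe_le_norm _)

theorem toL1_displace (hξ : Measurable ξ) (hi : Integrable ξ π) (u : Phase d →ᵇ Phase d) :
    (integrable_displace hξ hi u).toL1 (fun w => displace u (ξ w)) =
      hi.toL1 ξ + weightedComp π hξ hi u :=
  Integrable.toL1_add _ _ hi (integrable_weight_smul hξ hi u)

theorem norm_displace_le (u : Phase d →ᵇ Phase d) (z : Phase d) :
    ‖displace u z‖ ≤ (1 + ‖z‖) * (1 + ‖u‖) := by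
  have h := u.norm_coe_le_norm z
  calc ‖displace u z‖ ≤ ‖z‖ + ‖(1 + ‖z‖) • u z‖ := norm_add_le _ _
    _ = ‖z‖ + (1 + ‖z‖) * ‖u z‖ := by rw [norm_smul, Real.norm_of_nonneg (by positivity)]
    _ ≤ (1 + ‖z‖) + (1 + ‖z‖) * ‖u‖ := by gcongr; linarith
    _ = _ := by ring

variable (hK : IsLipschitzKernel K L)

theorem integrable_displace_id (f : P1 d) (u : Phase d →ᵇ Phase d) :
    Integrable (displace u) f.toMeasure :=
  integrable_displace measurable_id f.integrable_id u

include hK in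
-- The weight `1 + ‖z‖` absorbs the linear growth of the force, so the rescaled velocity is again a
-- bounded function.
theorem norm_displacementField_le (f : P1 d) (u : Phase d →ᵇ Phase d) (z : Phase d) :
    ‖(1 + ‖z‖)⁻¹ • interaction K f.toMeasure (displace u) (displace u z)‖ ≤
      L * ((1 + ‖u‖) + ∫ z, ‖displace u z‖ ∂f.toMeasure) := by
  have hz : (1 : ℝ) ≤ 1 + ‖z‖ := by linarith [norm_nonneg z]
  have hI : 0 ≤ ∫ z, ‖displace u z‖ ∂f.toMeasure := integral_nonneg fun _ => norm_nonneg _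
  rw [norm_smul, norm_inv, Real.norm_of_nonneg (by positivity),
    inv_mul_le_iff₀ (by positivity)]
  refine (hK.norm_interaction_le (integrable_displace_id f u) _).trans ?_
  rw [mul_left_comm]
  gcongr
  rw [mul_add]
  gcongr
  · exact norm_displace_le u z
  · exact le_mul_of_one_le_left hI hz

/-- The vector field governing the weighted displacements of the characteristics. -/
def displacementField (f : P1 d) (u : Phase d →ᵇ Phase d) : Phase d →ᵇ Phase d :=
  BoundedContinuousFunction.ofNormedAddCommGroup
    (fun z => (1 + ‖z‖)⁻¹ • interaction K f.toMeasure (displace u) (displace u z))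
    (((continuous_const.add continuous_norm).inv₀ fun z => ne_of_gt (by positivity : 0 < 1 + ‖z‖)).smul
      ((hK.continuous_interaction (integrable_displace_id f u)).comp (continuous_displace u)))
    _ (norm_displacementField_le hK f u)

theorem displacementField_apply (f : P1 d) (u : Phase d →ᵇ Phase d) (z : Phase d) :
    (1 + ‖z‖) • displacementField hK f u z =
      interaction K f.toMeasure (displace u) (displace u z) := by
  have hz : (1 + ‖z‖) ≠ 0 := by positivity
  exact smul_inv_smul₀ hz _

theorem norm_displace_sub_le (u v : Phase d →ᵇ Phase d) (z : Phase d) :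
    ‖displace u z - displace v z‖ ≤ (1 + ‖z‖) * dist u v := by
  rw [displace, displace, add_sub_add_left_eq_sub, ← smul_sub, norm_smul,
    Real.norm_of_nonneg (by positivity), ← dist_eq_norm]
  gcongr
  exact BoundedContinuousFunction.dist_coe_le_dist z

/-- The position contributes `1` and the averaged displacement contributes `∫ (1 + ‖z‖) f(dz) = 1 +
f.moment`. The constant depends on `f`, but it is used only for existence; the sharp rate comes from
the equation in `L¹`. -/
theorem lipschitzWith_displacementField (f : P1 d) :
    LipschitzWith (L * (1 + ⟨1 + f.moment, by linarith [f.moment_nonneg]⟩))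
      (displacementField hK f) := by
  refine LipschitzWith.of_dist_le_mul fun u v => ?_
  refine (BoundedContinuousFunction.dist_le (by positivity)).2 fun z => ?_
  have hz : (1 : ℝ) ≤ 1 + ‖z‖ := by linarith [norm_nonneg z]
  have hM : (0 : ℝ) ≤ 1 + f.moment := by linarith [f.moment_nonneg]
  have hint : ∫ z, ‖displace u z - displace v z‖ ∂f.toMeasure ≤ (1 + f.moment) * dist u v := by
    have hi : Integrable (fun z : Phase d => 1 + ‖z‖) f.toMeasure :=
      (integrable_const _).add f.integrable_id.norm
    refine (integral_mono ((integrable_displace_id f u).sub (integrable_displace_id f v)).norm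
      (hi.mul_const (dist u v)) (norm_displace_sub_le u v)).trans (le_of_eq ?_)
    rw [integral_mul_const, integral_add (integrable_const _) f.integrable_id.norm]
    simp [P1.moment]
  have h := hK.norm_interaction_sub_le (integrable_displace_id f u) (integrable_displace_id f v)
    (displace u z) (displace v z)
  change dist ((1 + ‖z‖)⁻¹ • interaction K f.toMeasure (displace u) (displace u z))
    ((1 + ‖z‖)⁻¹ • interaction K f.toMeasure (displace v) (displace v z)) ≤ _
  rw [dist_eq_norm, ← smul_sub, norm_smul, norm_inv, Real.norm_of_nonneg (by positivity),
    inv_mul_le_iff₀ (by positivity)]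
  refine h.trans ?_
  push_cast
  change _ ≤ (1 + ‖z‖) * (L * (1 + (1 + f.moment)) * dist u v)
  calc L * ‖displace u z - displace v z‖ + L * ∫ z, ‖displace u z - displace v z‖ ∂f.toMeasure
      ≤ L * ((1 + ‖z‖) * dist u v) + L * ((1 + ‖z‖) * ((1 + f.moment) * dist u v)) := by
        gcongr
        · exact norm_displace_sub_le u v z
        · exact hint.trans (le_mul_of_one_le_left (by positivity) hz)
    _ = _ := by ring

/-- The weighted displacement at time `t` of the characteristics of the Vlasov equation with
initial datum `f`. -/
def displacement (f : P1 d) : ℝ → (Phase d →ᵇ Phase d) :=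
  ((lipschitzWith_displacementField hK f).exists_global_solution 0).choose

theorem displacement_zero (f : P1 d) : displacement hK f 0 = 0 :=
  ((lipschitzWith_displacementField hK f).exists_global_solution 0).choose_spec.1

theorem hasDerivAt_displacement (f : P1 d) (t : ℝ) :
    HasDerivAt (displacement hK f) (displacementField hK f (displacement hK f t)) t :=
  ((lipschitzWith_displacementField hK f).exists_global_solution 0).choose_spec.2 t

/-- The position at time `t` of the characteristic of the Vlasov equation issued from `z`, when
the initial datum is `f`. -/
def characteristic (f : P1 d) (t : ℝ) (z : Phase d) : Phase d := displace (displacement hK f t) z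

theorem characteristic_zero (f : P1 d) (z : Phase d) : characteristic hK f 0 z = z := by
  simp [characteristic, displacement_zero, displace]

theorem continuous_characteristic (f : P1 d) (t : ℝ) : Continuous (characteristic hK f t) :=
  continuous_displace _

theorem integrable_characteristic_comp (f : P1 d) (t : ℝ) (hξ : Measurable ξ)
    (hi : Integrable ξ π) : Integrable (fun w => characteristic hK f t (ξ w)) π :=
  integrable_displace hξ hi _

theorem integrable_characteristic (f : P1 d) (t : ℝ) :
    Integrable (characteristic hK f t) f.toMeasure :=
  integrable_displace_id f _

theorem hasDerivAt_characteristic (f : P1 d) (t : ℝ) (z : Phase d) :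
    HasDerivAt (fun s => characteristic hK f s z)
      (interaction K f.toMeasure (characteristic hK f t) (characteristic hK f t z)) t := by
  -- Evaluation at `z` is a continuous linear map, so the Banach-space derivative yields the
  -- pointwise one.
  have h := (BoundedContinuousFunction.evalCLM ℝ z).hasFDerivAt.comp_hasDerivAt t
    (hasDerivAt_displacement hK f t)
  have h2 := (h.const_smul (1 + ‖z‖)).const_add z
  have h3 := displacementField_apply hK f (displacement hK f t) z
  exact HasDerivAt.congr_deriv h2 h3

/-- Along the characteristics, every random variable with law `f` is transported by the mean-field
vector field on `L¹`. -/
theorem hasDerivAt_toL1_characteristic (f : P1 d) (hξ : Measurable ξ) (hi : Integrable ξ π)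
    (hf : π.map ξ = f.toMeasure) (t : ℝ) :
    HasDerivAt (fun s => (integrable_characteristic_comp hK f s hξ hi).toL1
        (fun w => characteristic hK f s (ξ w)))
      (lagrangianField hK π ((integrable_characteristic_comp hK f t hξ hi).toL1
        (fun w => characteristic hK f t (ξ w)))) t := by
  have h := ((weightedComp π hξ hi).hasFDerivAt.comp_hasDerivAt t
    (hasDerivAt_displacement hK f t)).const_add (hi.toL1 ξ)
  refine (h.congr_of_eventuallyEq
    (Eventually.of_forall fun s => toL1_displace hξ hi _)).congr_deriv ?_
  rw [lagrangianField_toL1]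
  refine (Integrable.toL1_eq_toL1_iff _ _ (integrable_weight_smul hξ hi _) _).2
    (Eventually.of_forall fun w => ?_)
  simp only
  -- The force computed with `f` equals the force computed with samples of `ξ`, since `ξ` has law
  -- `f`. Hence the `L¹` equation no longer mentions `f`.
  rw [displacementField_apply, interaction, interaction, ← hf, integral_map hξ.aemeasurable]
  · rfl
  · exact (hK.continuous_uncurry.comp (by fun_prop : Continuous fun z : Phase d =>
      (displace (displacement hK f t) (ξ w), z))
      |>.comp (continuous_displace _)).aestronglyMeasurable

end Characteristics

/-! ### The Vlasov flow on `𝒫₁(ℝ^d)` -/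

section VlasovFlow

variable {d : ℕ} {Ω : Type*} [MeasurableSpace Ω] {K : Phase d → Phase d → Phase d} {L : NNReal}
  {π : Measure Ω} [IsProbabilityMeasure π] {ξ η : Ω → Phase d}
  (hK : IsLipschitzKernel K L)

/-- The flow on `𝒫₁(ℝ^d)` of the Vlasov equation. -/
def vlasovFlow (t : ℝ) (f : P1 d) : P1 d :=
  P1.law f.toMeasure (characteristic hK f t) (continuous_characteristic hK f t).measurable
    (integrable_characteristic hK f t)

theorem vlasovFlow_toMeasure (t : ℝ) (f : P1 d) :
    (vlasovFlow hK t f).toMeasure = f.toMeasure.map (characteristic hK f t) := rfl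

theorem vlasovFlow_zero (f : P1 d) : vlasovFlow hK 0 f = f := by
  ext1
  rw [vlasovFlow_toMeasure, funext (characteristic_zero hK f)]
  exact Measure.map_id

/-- Dobrushin's estimate for random variables: although the laws `f` and `g` differ, both curves
solve the same equation in `L¹(π)`, and Gronwall's lemma applies. -/
theorem lintegral_edist_characteristic_le {f g : P1 d} (hξ : Measurable ξ) (hη : Measurable η)
    (hf : π.map ξ = f.toMeasure) (hg : π.map η = g.toMeasure) (t : ℝ) :
    ∫⁻ w, edist (characteristic hK f t (ξ w)) (characteristic hK g t (η w)) ∂π ≤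
      ENNReal.ofReal (Real.exp (2 * L * |t|)) * ∫⁻ w, edist (ξ w) (η w) ∂π := by
  have hξi : Integrable ξ π := by
    have := f.integrable_id
    rw [← hf] at this
    exact this.comp_measurable hξ
  have hηi : Integrable η π := by
    have := g.integrable_id
    rw [← hg] at this
    exact this.comp_measurable hη
  have h := dist_le_of_global_solutions (lipschitzWith_lagrangianField hK)
    (hasDerivAt_toL1_characteristic hK f hξ hξi hf)
    (hasDerivAt_toL1_characteristic hK g hη hηi hg) t
  have h' := ENNReal.ofReal_le_ofReal h
  rw [ENNReal.ofReal_mul (Real.exp_nonneg _), ← edist_dist, ← edist_dist,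
    Integrable.edist_toL1_toL1, Integrable.edist_toL1_toL1] at h'
  simpa only [characteristic_zero, NNReal.coe_mul, NNReal.coe_ofNat] using h'

theorem distMK_vlasovFlow_le (t : ℝ) (f g : P1 d) :
    distMK (vlasovFlow hK t f) (vlasovFlow hK t g) ≤
      ENNReal.ofReal (Real.exp (2 * L * |t|)) * distMK f g := by
  have h0 : ENNReal.ofReal (Real.exp (2 * L * |t|)) ≠ 0 := by
    simpa using Real.exp_pos _
  -- Dividing by the exponential leaves a lower bound for an infimum, to be checked on every
  -- coupling. No optimal coupling is needed.
  rw [← ENNReal.div_le_iff' h0 ENNReal.ofReal_ne_top]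
  refine le_iInf₂ fun ρ hρ => ?_
  rw [ENNReal.div_le_iff' h0 ENNReal.ofReal_ne_top]
  have hp : IsProbabilityMeasure ρ := by
    constructor
    have := measure_univ (μ := f.toMeasure)
    rwa [← hρ.1, Measure.map_apply measurable_fst MeasurableSet.univ, Set.preimage_univ] at this
  refine le_trans ?_ (lintegral_edist_characteristic_le hK measurable_fst measurable_snd
    hρ.1 hρ.2 t)
  have hm : ∀ h : P1 d, Measurable (characteristic hK h t) := fun h =>
    (continuous_characteristic hK h t).measurable
  refine le_trans (le_of_eq ?_) (transportCost_map_le (c := fun x y : Phase d => edist x y)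
    (π := ρ) ((hm f).comp measurable_fst) ((hm g).comp measurable_snd))
  change _ = transportCost _ (ρ.map (characteristic hK f t ∘ Prod.fst))
    (ρ.map (characteristic hK g t ∘ Prod.snd))
  rw [← Measure.map_map (hm f) measurable_fst, ← Measure.map_map (hm g) measurable_snd, hρ.1, hρ.2]
  rfl

theorem continuous_vlasovFlow (t : ℝ) : Continuous (vlasovFlow hK t : P1 d → P1 d) :=
  (show LipschitzWith (Real.exp (2 * L * |t|)).toNNReal (vlasovFlow hK t) from
    distMK_vlasovFlow_le hK t).continuous

theorem measurable_vlasovFlow (t : ℝ) : Measurable (vlasovFlow hK t : P1 d → P1 d) :=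
  (continuous_vlasovFlow hK t).measurable

/-- As functions of `s`, `X_g(s, X_f(t, ·))` and `X_f(s + t, ·)` solve the same equation in `L¹(f)`
with equal values at `s = 0`. They agree `f`-almost everywhere, which is enough for push-forwards.
-/
theorem vlasovFlow_add (s t : ℝ) (f : P1 d) :
    vlasovFlow hK (s + t) f = vlasovFlow hK s (vlasovFlow hK t f) := by
  set g := vlasovFlow hK t f with hg
  have hm : ∀ (h : P1 d) t, Measurable (characteristic hK h t) := fun h t =>
    (continuous_characteristic hK h t).measurable
  have hx := hasDerivAt_toL1_characteristic hK g (hm f t) (integrable_characteristic hK f t)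
    (vlasovFlow_toMeasure hK t f).symm
  have hy := fun s => (hasDerivAt_toL1_characteristic hK f measurable_id f.integrable_id
    Measure.map_id (s + t)).comp_add_const s t
  have h := dist_le_of_global_solutions (lipschitzWith_lagrangianField hK) hx hy s
  have h0 : dist ((integrable_characteristic_comp hK g 0 (hm f t)
      (integrable_characteristic hK f t)).toL1
        (fun w => characteristic hK g 0 (characteristic hK f t w)))
      ((integrable_characteristic_comp hK f (0 + t) measurable_id f.integrable_id).toL1
        (fun w => characteristic hK f (0 + t) (id w))) = 0 := by
    simp only [characteristic_zero, zero_add, id, dist_self]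
  rw [h0, mul_zero] at h
  have h1 := (Integrable.toL1_eq_toL1_iff _ _ _ _).1 (dist_le_zero.1 h)
  ext1
  rw [vlasovFlow_toMeasure, vlasovFlow_toMeasure, hg, vlasovFlow_toMeasure,
    Measure.map_map (hm _ s) (hm f t), ← hg]
  exact (Measure.map_congr h1).symm

/-! ### Growth bounds, time regularity and propagation of moments -/

theorem integral_norm_characteristic_le (f : P1 d) (t : ℝ) :
    ∫ z, ‖characteristic hK f t z‖ ∂f.toMeasure ≤ Real.exp (2 * L * |t|) * f.moment := by
  have h := dist_le_of_global_solutions (lipschitzWith_lagrangianField hK)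
    (hasDerivAt_toL1_characteristic hK f measurable_id f.integrable_id Measure.map_id)
    (y := fun _ => 0) (fun t => by
      rw [lagrangianField_zero]; exact hasDerivAt_const _ _) t
  rw [dist_zero_right, dist_zero_right, L1.norm_of_fun_eq_integral_norm,
    L1.norm_of_fun_eq_integral_norm] at h
  simpa [characteristic_zero, P1.moment] using h

theorem moment_vlasovFlow_le (t : ℝ) (f : P1 d) :
    (vlasovFlow hK t f).moment ≤ Real.exp (2 * L * |t|) * f.moment := by
  refine le_of_eq_of_le ?_ (integral_norm_characteristic_le hK f t)
  rw [P1.moment, vlasovFlow_toMeasure,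
    integral_map (continuous_characteristic hK f t).aemeasurable
      continuous_norm.aestronglyMeasurable]

theorem norm_le_of_norm_deriv_le {E : Type*} [NormedAddCommGroup E] [NormedSpace ℝ E]
    {x x' : ℝ → E} {k ε τ : ℝ} (hk : 1 ≤ k) (hε : 0 ≤ ε) (hx : ∀ t, HasDerivAt x (x' t) t)
    (hb : ∀ t, |t| ≤ τ → ‖x' t‖ ≤ k * ‖x t‖ + ε) {t : ℝ} (ht : |t| ≤ τ) :
    ‖x t‖ ≤ Real.exp (k * τ) * (‖x 0‖ + ε) := by
  have key : ∀ x x' : ℝ → E, (∀ t, HasDerivAt x (x' t) t) →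
      (∀ t, |t| ≤ τ → ‖x' t‖ ≤ k * ‖x t‖ + ε) → ∀ t, |t| ≤ τ → 0 ≤ t →
      ‖x t‖ ≤ Real.exp (k * τ) * (‖x 0‖ + ε) := by
    intro x x' hx hb t ht ht0
    rw [abs_of_nonneg ht0] at ht
    have h := norm_le_gronwallBound_of_norm_deriv_right_le (K := k) (ε := ε)
      (fun s _ => (hx s).continuousAt.continuousWithinAt) (fun s _ => (hx s).hasDerivWithinAt)
      le_rfl (fun s (hs : s ∈ Set.Ico 0 t) => hb s (by
        rw [abs_of_nonneg hs.1]; exact hs.2.le.trans ht)) t ⟨ht0, le_rfl⟩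
    rw [gronwallBound_of_K_ne_0 (by positivity), sub_zero] at h
    have h1 : Real.exp (k * t) ≤ Real.exp (k * τ) := Real.exp_le_exp.2 (by gcongr)
    have h2 : ε / k ≤ ε := div_le_self hε hk
    have h3 : 0 ≤ ε / k := by positivity
    calc ‖x t‖ ≤ ‖x 0‖ * Real.exp (k * t) + ε / k * (Real.exp (k * t) - 1) := h
      _ ≤ ‖x 0‖ * Real.exp (k * t) + ε / k * Real.exp (k * t) := by gcongr; linarith
      _ ≤ ‖x 0‖ * Real.exp (k * τ) + ε * Real.exp (k * τ) := by gcongr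
      _ = _ := by ring
  rcases le_total 0 t with h | h
  · exact key x x' hx hb t ht h
  · have := key (fun s => x (-s)) (fun s => -x' (-s))
      (fun s => by simpa [Function.comp_def] using (hx (-s)).scomp s (hasDerivAt_neg s))
      (fun s hs => by simpa using hb (-s) (by simpa using hs)) (-t) (by simpa using ht)
      (by linarith)
    simpa using this

/-- A bound for the growth up to time `τ` of the characteristics and of their velocities. -/
def growthConst (L : NNReal) (τ : ℝ) : ℝ :=
  (L + 1) * (Real.exp ((L + 1) * τ) + (Real.exp ((L + 1) * τ) * L + 1) * Real.exp (2 * L * τ))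

theorem growthConst_nonneg (L : NNReal) (τ : ℝ) : 0 ≤ growthConst L τ := by
  unfold growthConst; positivity

/-- The speed is at most `L` times the position plus `L` times the current first moment. The latter
is already controlled on `[-τ, τ]`, so it acts as a constant source in Gronwall's lemma. The rate `L
+ 1` satisfies the condition `1 ≤ k`. -/
theorem norm_characteristic_le_exp (f : P1 d) {t τ : ℝ} (ht : |t| ≤ τ) (z : Phase d) :
    ‖characteristic hK f t z‖ ≤
      Real.exp ((L + 1) * τ) * (‖z‖ + L * (Real.exp (2 * L * τ) * f.moment)) := by
  have hM := f.moment_nonneg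
  have h := norm_le_of_norm_deriv_le (k := L + 1) (ε := L * (Real.exp (2 * L * τ) * f.moment))
    (by simp) (by positivity) (hasDerivAt_characteristic hK f · z) (fun s hs => ?_) ht
  · rwa [characteristic_zero] at h
  · refine (hK.norm_interaction_le (integrable_characteristic hK f s) _).trans ?_
    have h1 := integral_norm_characteristic_le hK f s
    have h2 : Real.exp (2 * L * |s|) ≤ Real.exp (2 * L * τ) := Real.exp_le_exp.2 (by gcongr)
    calc L * (‖characteristic hK f s z‖ + ∫ z, ‖characteristic hK f s z‖ ∂f.toMeasure)
        ≤ L * (‖characteristic hK f s z‖ + Real.exp (2 * L * τ) * f.moment) := by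
          gcongr
          exact h1.trans (by gcongr)
      _ ≤ (L + 1) * ‖characteristic hK f s z‖ + L * (Real.exp (2 * L * τ) * f.moment) := by
          linarith [norm_nonneg (characteristic hK f s z)]

theorem norm_characteristic_le (f : P1 d) {t τ : ℝ} (ht : |t| ≤ τ) (z : Phase d) :
    ‖characteristic hK f t z‖ ≤ growthConst L τ * (‖z‖ + f.moment) := by
  have hM := f.moment_nonneg
  refine (norm_characteristic_le_exp hK f ht z).trans ?_
  have h1 := Real.exp_pos ((L + 1) * τ)
  have h2 := Real.exp_pos (2 * L * τ)
  have hz := norm_nonneg z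
  -- `growthConst` dominates separately the coefficient of `‖z‖` and that of `f.moment`; each
  -- difference is a sum of nonnegative terms.
  have e1 : 0 ≤ growthConst L τ - Real.exp ((L + 1) * τ) := by
    have : growthConst L τ - Real.exp ((L + 1) * τ) = L * Real.exp ((L + 1) * τ) +
      (L + 1) * ((Real.exp ((L + 1) * τ) * L + 1) * Real.exp (2 * L * τ)) := by
      unfold growthConst; ring
    rw [this]; positivity
  have e2 : 0 ≤ growthConst L τ - Real.exp ((L + 1) * τ) * L * Real.exp (2 * L * τ) := by
    have : growthConst L τ - Real.exp ((L + 1) * τ) * L * Real.exp (2 * L * τ) =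
      (L + 1) * Real.exp ((L + 1) * τ) + (L + 1) * Real.exp (2 * L * τ) +
      L * (Real.exp ((L + 1) * τ) * L * Real.exp (2 * L * τ)) := by
      unfold growthConst; ring
    rw [this]; positivity
  linarith [mul_nonneg e1 hz, mul_nonneg e2 hM]

theorem norm_velocity_le (f : P1 d) {t τ : ℝ} (ht : |t| ≤ τ) (z : Phase d) :
    ‖interaction K f.toMeasure (characteristic hK f t) (characteristic hK f t z)‖ ≤
      growthConst L τ * (‖z‖ + f.moment) := by
  have hM := f.moment_nonneg
  have hz := norm_nonneg z
  have h1 := norm_characteristic_le_exp hK f ht z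
  have h2 : ∫ z, ‖characteristic hK f t z‖ ∂f.toMeasure ≤ Real.exp (2 * L * τ) * f.moment := by
    refine (integral_norm_characteristic_le hK f t).trans ?_
    gcongr
  refine (hK.norm_interaction_le (integrable_characteristic hK f t) _).trans ?_
  calc _ ≤ L * (Real.exp ((L + 1) * τ) * (‖z‖ + L * (Real.exp (2 * L * τ) * f.moment)) +
        Real.exp (2 * L * τ) * f.moment) := by gcongr
    _ = L * (Real.exp ((L + 1) * τ) * ‖z‖ +
      ((Real.exp ((L + 1) * τ) * L + 1) * Real.exp (2 * L * τ)) * f.moment) := by ring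
    _ ≤ (L + 1) * ((Real.exp ((L + 1) * τ) +
        (Real.exp ((L + 1) * τ) * L + 1) * Real.exp (2 * L * τ)) * (‖z‖ + f.moment)) := by
      gcongr
      · linarith
      · have a1 : 0 ≤ Real.exp ((L + 1) * τ) * f.moment := by positivity
        have a2 : 0 ≤ ((Real.exp ((L + 1) * τ) * L + 1) * Real.exp (2 * L * τ)) * ‖z‖ := by
          positivity
        linarith
    _ = _ := by unfold growthConst; ring

/-- Couple the two times by starting from the same point and apply the mean value inequality. The
factor `2` comes from integrating `‖z‖ + f.moment` against `f`. -/
theorem distMK_vlasovFlow_time_le (f : P1 d) {s t τ : ℝ} (hs : |s| ≤ τ) (ht : |t| ≤ τ) :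
    distMK (vlasovFlow hK t f) (vlasovFlow hK s f) ≤
      ENNReal.ofReal (2 * growthConst L τ * |t - s| * f.moment) := by
  have hm : ∀ t, Measurable (characteristic hK f t) := fun t =>
    (continuous_characteristic hK f t).measurable
  have hC := growthConst_nonneg L τ
  refine (transportCost_map_le (hm t) (hm s)).trans ?_
  have hpt : ∀ z, edist (characteristic hK f t z) (characteristic hK f s z) ≤
      ENNReal.ofReal (growthConst L τ * (‖z‖ + f.moment) * |t - s|) := by
    intro z
    rw [edist_dist, dist_eq_norm]
    refine ENNReal.ofReal_le_ofReal ?_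
    exact (convex_Icc (-τ) τ).norm_image_sub_le_of_norm_hasDerivWithin_le
      (fun r _ => (hasDerivAt_characteristic hK f r z).hasDerivWithinAt)
      (fun r hr => norm_velocity_le hK f (abs_le.2 hr) z) (abs_le.1 hs) (abs_le.1 ht)
  refine (lintegral_mono hpt).trans (le_of_eq ?_)
  have hi : Integrable (fun z : Phase d => growthConst L τ * (‖z‖ + f.moment) * |t - s|)
      f.toMeasure := ((f.integrable_id.norm.add (integrable_const _)).const_mul _).mul_const _
  have hM := f.moment_nonneg
  rw [← ofReal_integral_eq_lintegral_ofReal hi (Eventually.of_forall fun z => by positivity),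
    integral_mul_const, integral_const_mul, integral_add f.integrable_id.norm (integrable_const _)]
  congr 1
  simp only [integral_const, probReal_univ, one_smul]
  change growthConst L τ * (f.moment + f.moment) * |t - s| = _
  ring

omit hK in
theorem moment_pow_le (p : ℕ) (f : P1 d) :
    ENNReal.ofReal f.moment ^ (p + 1) ≤ ∫⁻ z, ‖z‖ₑ ^ (p + 1) ∂f.toMeasure := by
  have h1 : eLpNorm (fun z : Phase d => z) 1 f.toMeasure ≤
      eLpNorm (fun z : Phase d => z) ((p + 1 : ℕ) : NNReal) f.toMeasure :=
    eLpNorm_le_eLpNorm_of_exponent_le (by simp) f.integrable_id.1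
  rw [eLpNorm_one_eq_lintegral_enorm, ← f.ofReal_moment] at h1
  have h2 := eLpNorm_nnreal_pow_eq_lintegral (f := fun z : Phase d => z) (μ := f.toMeasure)
    (p := ((p + 1 : ℕ) : NNReal)) (by positivity)
  simp only [NNReal.coe_natCast, ENNReal.rpow_natCast] at h2
  rw [← h2]
  gcongr

/-- Bounding `a + b` by `2 max(a, b)` before taking powers replaces the binomial expansion. The
power of the first moment is then absorbed by `moment_pow_le`. -/
theorem lintegral_pow_vlasovFlow_le (p : ℕ) (t : ℝ) (f : P1 d) :
    ∫⁻ z, ‖z‖ₑ ^ (p + 1) ∂(vlasovFlow hK t f).toMeasure ≤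
      2 * ENNReal.ofReal (2 * growthConst L |t|) ^ (p + 1) *
        ∫⁻ z, ‖z‖ₑ ^ (p + 1) ∂f.toMeasure := by
  have hC := growthConst_nonneg L |t|
  rw [vlasovFlow_toMeasure, lintegral_map (by fun_prop)
    (continuous_characteristic hK f t).measurable]
  have hpt : ∀ z : Phase d, ‖characteristic hK f t z‖ₑ ^ (p + 1) ≤
      ENNReal.ofReal (2 * growthConst L |t|) ^ (p + 1) *
        (‖z‖ₑ ^ (p + 1) + ENNReal.ofReal f.moment ^ (p + 1)) := by
    intro z
    have h1 : ‖characteristic hK f t z‖ₑ ≤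
        ENNReal.ofReal (2 * growthConst L |t|) * max ‖z‖ₑ (ENNReal.ofReal f.moment) := by
      rw [← ofReal_norm, ← ofReal_norm, ← ENNReal.ofReal_max,
        ← ENNReal.ofReal_mul (by positivity)]
      refine ENNReal.ofReal_le_ofReal ((norm_characteristic_le hK f le_rfl z).trans ?_)
      have := add_le_add (le_max_left ‖z‖ f.moment) (le_max_right ‖z‖ f.moment)
      nlinarith
    calc _ ≤ (ENNReal.ofReal (2 * growthConst L |t|) *
          max ‖z‖ₑ (ENNReal.ofReal f.moment)) ^ (p + 1) := by gcongr
      _ ≤ _ := by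
        rw [mul_pow]
        gcongr
        rcases le_total ‖z‖ₑ (ENNReal.ofReal f.moment) with h | h
        · rw [max_eq_right h]; exact le_add_self
        · rw [max_eq_left h]; exact le_self_add
  refine (lintegral_mono hpt).trans ?_
  rw [lintegral_const_mul _ (by fun_prop), lintegral_add_left (by fun_prop), lintegral_const,
    measure_univ, mul_one, mul_comm 2 (_ ^ _), mul_assoc]
  gcongr
  rw [two_mul]
  gcongr
  exact moment_pow_le p f

/-! ### The push-forward of the Vlasov flow -/

theorem DistMK_map_vlasovFlow_le (t : ℝ) (P Q : Measure (P1 d)) :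
    DistMK (P.map (vlasovFlow hK t)) (Q.map (vlasovFlow hK t)) ≤
      ENNReal.ofReal (Real.exp (2 * L * |t|)) * DistMK P Q := by
  have h0 : ENNReal.ofReal (Real.exp (2 * L * |t|)) ≠ 0 := by
    simpa using Real.exp_pos _
  have hm := measurable_vlasovFlow hK t
  rw [← ENNReal.div_le_iff' h0 ENNReal.ofReal_ne_top]
  refine le_iInf₂ fun ρ hρ => ?_
  rw [ENNReal.div_le_iff' h0 ENNReal.ofReal_ne_top, ← lintegral_const_mul' _ _ ENNReal.ofReal_ne_top]
  refine le_trans ?_ (lintegral_mono fun p => distMK_vlasovFlow_le hK t p.1 p.2)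
  refine le_trans (le_of_eq ?_) (transportCost_map_le (c := distMK)
    (π := ρ) (hm.comp measurable_fst) (hm.comp measurable_snd))
  change _ = transportCost _ (ρ.map (vlasovFlow hK t ∘ Prod.fst))
    (ρ.map (vlasovFlow hK t ∘ Prod.snd))
  rw [← Measure.map_map hm measurable_fst, ← Measure.map_map hm measurable_snd, hρ.1, hρ.2]
  rfl

theorem map_vlasovFlow_mem_P1P1 (t : ℝ) {P : Measure (P1 d)} (hP : P ∈ P1P1 d) :
    P.map (vlasovFlow hK t) ∈ P1P1 d := by
  have := hP.1
  refine ⟨Measure.isProbabilityMeasure_map (measurable_vlasovFlow hK t).aemeasurable, ?_⟩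
  have hb : ∀ f : P1 d, distMK (vlasovFlow hK t f) (P1.dirac 0) ≤
      ENNReal.ofReal (Real.exp (2 * L * |t|)) * distMK f (P1.dirac 0) := fun f => by
    rw [distMK_dirac_zero, distMK_dirac_zero, ← P1.ofReal_moment, ← P1.ofReal_moment,
      ← ENNReal.ofReal_mul (Real.exp_nonneg _)]
    exact ENNReal.ofReal_le_ofReal (moment_vlasovFlow_le hK t f)
  refine (lintegral_map_le _ _).trans_lt ((lintegral_mono hb).trans_lt ?_)
  rw [lintegral_const_mul' _ _ ENNReal.ofReal_ne_top]
  exact ENNReal.mul_lt_top ENNReal.ofReal_lt_top hP.2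

theorem map_vlasovFlow_mem_setE (t : ℝ) {P : Measure (P1 d)} (hP : P ∈ setE d) :
    P.map (vlasovFlow hK t) ∈ setE d := by
  refine ⟨map_vlasovFlow_mem_P1P1 hK t hP.1, (lintegral_map_le _ _).trans_lt
    -- The value `d + 4` gives the exponent `d + 5` of `setE`, since the lemma is stated for `p +
    -- 1`.
    ((lintegral_mono (lintegral_pow_vlasovFlow_le hK (d + 4) t)).trans_lt ?_)⟩
  have hC : 2 * ENNReal.ofReal (2 * growthConst L |t|) ^ (d + 4 + 1) ≠ ⊤ := by finiteness
  rw [lintegral_const_mul' _ _ hC]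
  exact ENNReal.mul_lt_top hC.lt_top hP.2

theorem tendsto_DistMK_map_vlasovFlow {P : Measure (P1 d)} (hP : P ∈ P1P1 d) (t₀ : ℝ) :
    Tendsto (fun t => DistMK (P.map (vlasovFlow hK t)) (P.map (vlasovFlow hK t₀)))
      (𝓝 t₀) (𝓝 0) := by
  set τ := |t₀| + 1
  set C := ENNReal.ofReal (2 * growthConst L τ) * ∫⁻ f, ENNReal.ofReal f.moment ∂P with hCdef
  have hC : C ≠ ⊤ := by
    refine ENNReal.mul_ne_top ENNReal.ofReal_ne_top (ne_of_lt ?_)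
    refine lt_of_eq_of_lt (lintegral_congr fun f => ?_) hP.2
    rw [distMK_dirac_zero, f.ofReal_moment]
  have hlim : Tendsto (fun t => C * ENNReal.ofReal |t - t₀|) (𝓝 t₀) (𝓝 0) := by
    have h1 : Tendsto (fun t => ENNReal.ofReal |t - t₀|) (𝓝 t₀) (𝓝 0) := by
      have : Continuous fun t => ENNReal.ofReal |t - t₀| :=
        ENNReal.continuous_ofReal.comp (by fun_prop)
      simpa using this.tendsto t₀
    simpa using ENNReal.Tendsto.const_mul h1 (Or.inr hC)
  refine tendsto_of_tendsto_of_tendsto_of_le_of_le' tendsto_const_nhds hlim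
    (Eventually.of_forall fun _ => zero_le) ?_
  filter_upwards [Metric.ball_mem_nhds t₀ one_pos] with t ht
  have ht' : |t| ≤ τ := by
    rw [Metric.mem_ball, Real.dist_eq] at ht
    have := abs_sub_abs_le_abs_sub t t₀
    linarith
  have ht₀ : |t₀| ≤ τ := by simp [τ]
  have hg := growthConst_nonneg L τ
  refine (transportCost_map_le (measurable_vlasovFlow hK t) (measurable_vlasovFlow hK t₀)).trans
    ((lintegral_mono fun f => distMK_vlasovFlow_time_le hK f ht₀ ht').trans (le_of_eq ?_))
  have : ∀ f : P1 d, ENNReal.ofReal (2 * growthConst L τ * |t - t₀| * f.moment) =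
      ENNReal.ofReal (2 * growthConst L τ * |t - t₀|) * ENNReal.ofReal f.moment := fun f =>
    ENNReal.ofReal_mul (by positivity)
  simp only [this]
  rw [lintegral_const_mul' _ _ ENNReal.ofReal_ne_top, ENNReal.ofReal_mul (by positivity), hCdef]
  ring

/-! ### The `N`-particle system -/

/-- The tuple `Z` is viewed as a random variable on `Fin N` with the uniform measure, so that the
coupling tools for random variables apply to empirical measures. -/
theorem empiricalMeasure_eq_map {N : ℕ} [NeZero N] (Z : Fin N → Phase d) :
    (empiricalMeasure Z).toMeasure =
      ((N : ℝ≥0∞)⁻¹ • ∑ k : Fin N, Measure.dirac k).map Z := by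
  have hZ : Measurable Z := measurable_of_finite Z
  ext s hs
  rw [Measure.map_apply hZ hs]
  simp only [empiricalMeasure, Measure.smul_apply, Measure.finsetSum_apply,
    Measure.dirac_apply' _ hs, Measure.dirac_apply' _ (hZ hs)]
  rfl

theorem empiricalMeasure_comp {N : ℕ} [NeZero N] {g : Phase d → Phase d} (hg : Measurable g)
    (Z : Fin N → Phase d) :
    (empiricalMeasure fun k => g (Z k)).toMeasure = (empiricalMeasure Z).toMeasure.map g := by
  rw [empiricalMeasure_eq_map, empiricalMeasure_eq_map,
    Measure.map_map hg (measurable_of_finite Z)]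
  rfl

theorem distMK_empiricalMeasure_le {N : ℕ} [NeZero N] (Z W : Fin N → Phase d) :
    distMK (empiricalMeasure Z) (empiricalMeasure W) ≤
      (N : ℝ≥0∞)⁻¹ * ∑ k, edist (Z k) (W k) := by
  rw [distMK, empiricalMeasure_eq_map, empiricalMeasure_eq_map]
  refine (transportCost_map_le (measurable_of_finite Z) (measurable_of_finite W)).trans
    (le_of_eq ?_)
  rw [lintegral_smul_measure, lintegral_finsetSum_measure]
  simp

theorem continuous_empiricalMeasure {N : ℕ} [NeZero N] :
    Continuous (empiricalMeasure : (Fin N → Phase d) → P1 d) := by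
  refine (show LipschitzWith 1 _ from fun Z W => ?_).continuous
  rw [ENNReal.coe_one, one_mul]
  refine (distMK_empiricalMeasure_le Z W).trans ?_
  have hN : (N : ℝ≥0∞) ≠ 0 := by simpa using NeZero.ne N
  rw [← ENNReal.div_eq_inv_mul]
  refine ENNReal.div_le_of_le_mul' ((Finset.sum_le_sum fun k _ => edist_le_pi_edist Z W k).trans
    (le_of_eq ?_))
  simp

theorem measurable_empiricalMeasure {N : ℕ} [NeZero N] :
    Measurable (empiricalMeasure : (Fin N → Phase d) → P1 d) :=
  continuous_empiricalMeasure.measurable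

theorem integral_empiricalMeasure {N : ℕ} [NeZero N] {E : Type*} [NormedAddCommGroup E]
    [NormedSpace ℝ E] [CompleteSpace E] (Z : Fin N → Phase d) (g : Phase d → E) :
    ∫ z, g z ∂(empiricalMeasure Z).toMeasure = (N : ℝ)⁻¹ • ∑ k, g (Z k) := by
  change ∫ z, g z ∂((N : ℝ≥0∞)⁻¹ • ∑ k, Measure.dirac (Z k)) = _
  rw [integral_smul_measure, integral_finsetSum_measure fun k _ => integrable_dirac (by finiteness)]
  simp [integral_dirac]

/-- The vector field of the `N`-body problem. -/
def nBodyField (K : Phase d → Phase d → Phase d) {N : ℕ} (X : Fin N → Phase d) :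
    Fin N → Phase d :=
  fun k => (N : ℝ)⁻¹ • ∑ l, K (X k) (X l)

omit hK in
theorem IsNBodySolution.hasDerivAt {N : ℕ} {Z : Fin N → Phase d} {γ : ℝ → Fin N → Phase d}
    (h : IsNBodySolution K Z γ) (t : ℝ) : HasDerivAt γ (nBodyField K (γ t)) t :=
  hasDerivAt_pi.2 fun k => h.2 t k

include hK in
theorem lipschitzWith_nBodyField {N : ℕ} :
    LipschitzWith (2 * L) (nBodyField K : (Fin N → Phase d) → Fin N → Phase d) := by
  refine LipschitzWith.of_dist_le_mul fun X Y => (dist_pi_le_iff (by positivity)).2 fun k => ?_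
  have hN : (0 : ℝ) < N := by exact_mod_cast k.pos
  rw [nBodyField, nBodyField, dist_eq_norm, ← smul_sub, ← Finset.sum_sub_distrib, norm_smul,
    norm_inv, Real.norm_of_nonneg hN.le, inv_mul_le_iff₀ hN]
  have hl : ∀ l, ‖K (X k) (X l) - K (Y k) (Y l)‖ ≤ 2 * L * dist X Y := fun l => by
    refine (hK.norm_sub_le _ _ _ _).trans ?_
    rw [← dist_eq_norm, ← dist_eq_norm, two_mul, add_mul]
    gcongr
    · exact dist_le_pi_dist X Y k
    · exact dist_le_pi_dist X Y l
  refine (norm_sum_le_of_le _ fun l _ => hl l).trans (le_of_eq ?_)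
  simp

include hK in
theorem IsNBodySolution.dist_le {N : ℕ} {Z W : Fin N → Phase d} {γ γ' : ℝ → Fin N → Phase d}
    (h : IsNBodySolution K Z γ) (h' : IsNBodySolution K W γ') (t : ℝ) :
    dist (γ t) (γ' t) ≤ Real.exp ((2 * L : NNReal) * |t|) * dist Z W := by
  have := dist_le_of_global_solutions (lipschitzWith_nBodyField hK) h.hasDerivAt h'.hasDerivAt t
  rwa [h.1, h'.1] at this

/-- Integrating `K` against the empirical measure gives exactly the N-body sum, so the
characteristics issued from the atoms solve the particle system. This also supplies existence for
`nBodyFlow`. -/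
theorem isNBodySolution_characteristic {N : ℕ} [NeZero N] (Z : Fin N → Phase d) :
    IsNBodySolution K Z (fun t k => characteristic hK (empiricalMeasure Z) t (Z k)) := by
  refine ⟨funext fun k => characteristic_zero hK _ _, fun t k => ?_⟩
  have h := hasDerivAt_characteristic hK (empiricalMeasure Z) t (Z k)
  rwa [interaction, integral_empiricalMeasure] at h

include hK in
theorem isNBodySolution_nBodyFlow {N : ℕ} [NeZero N] (Z : Fin N → Phase d) :
    IsNBodySolution K Z (fun t => nBodyFlow K N t Z) := by
  have h : ∃ γ : ℝ → Fin N → Phase d, IsNBodySolution K Z γ :=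
    ⟨_, isNBodySolution_characteristic hK Z⟩
  have h' := h.choose_spec
  simpa only [nBodyFlow, dif_pos h] using h'

theorem nBodyFlow_eq {N : ℕ} [NeZero N] (t : ℝ) (Z : Fin N → Phase d) :
    nBodyFlow K N t Z = fun k => characteristic hK (empiricalMeasure Z) t (Z k) := by
  have := (isNBodySolution_nBodyFlow hK Z).dist_le hK (isNBodySolution_characteristic hK Z) t
  rw [dist_self, mul_zero] at this
  exact dist_le_zero.1 this

/-- The Vlasov flow transports empirical measures along the `N`-body flow. -/
theorem empiricalMeasure_nBodyFlow {N : ℕ} [NeZero N] (t : ℝ) (Z : Fin N → Phase d) :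
    empiricalMeasure (nBodyFlow K N t Z) = vlasovFlow hK t (empiricalMeasure Z) := by
  ext1
  rw [nBodyFlow_eq hK, empiricalMeasure_comp (continuous_characteristic hK _ t).measurable,
    vlasovFlow_toMeasure]

include hK in
theorem measurable_nBodyFlow {N : ℕ} [NeZero N] (t : ℝ) : Measurable (nBodyFlow K N t) := by
  have h : LipschitzWith (Real.exp ((2 * L : NNReal) * |t|)).toNNReal (nBodyFlow K N t) := by
    refine LipschitzWith.of_dist_le_mul fun Z W => ?_
    rw [Real.coe_toNNReal _ (Real.exp_nonneg _)]
    exact (isNBodySolution_nBodyFlow hK Z).dist_le hK (isNBodySolution_nBodyFlow hK W) t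
  exact h.continuous.measurable

theorem empiricalLaw_map_nBodyFlow {N : ℕ} [NeZero N] (t : ℝ) (P : Measure (Fin N → Phase d)) :
    empiricalLaw (P.map (nBodyFlow K N t)) = (empiricalLaw P).map (vlasovFlow hK t) := by
  rw [empiricalLaw, empiricalLaw, Measure.map_map measurable_empiricalMeasure
    (measurable_nBodyFlow hK t), Measure.map_map (measurable_vlasovFlow hK t)
    measurable_empiricalMeasure]
  congr 1
  exact funext fun Z => empiricalMeasure_nBodyFlow hK t Z

end VlasovFlow

/-! ### Empirical measures of independent samples -/

section Sampling

/-- Leave the common mass `min (p i) (p' i)` in place and move only the excess, at unit cost at most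
`D`. Truncated subtraction makes `p i - p' i` the positive part. -/
theorem transportCost_sum_dirac_le {X ι : Type*} [MeasurableSpace X] [Fintype ι]
    {c : X → X → ℝ≥0∞} (hc : Measurable fun x : X × X => c x.1 x.2) (hcc : ∀ x, c x x = 0)
    (a : ι → X) {p p' : ι → ℝ≥0∞} (hp : ∑ i, p i = 1) (hp' : ∑ i, p' i = 1) {D : ℝ≥0∞}
    (hD : ∀ i j, c (a i) (a j) ≤ D) :
    transportCost c (∑ i, p i • Measure.dirac (a i)) (∑ i, p' i • Measure.dirac (a i)) ≤
      D * ∑ i, (p i - p' i) := by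
  classical
  set m := ∑ i, (p i - p' i) with hm
  have hsplit : ∀ p p' : ι → ℝ≥0∞, ∑ i, (p i - p' i) + ∑ i, min (p i) (p' i) = ∑ i, p i := by
    intro p p'
    rw [← Finset.sum_add_distrib]
    exact Finset.sum_congr rfl fun i _ => tsub_add_min
  have hm' : ∑ i, (p' i - p i) = m := by
    have h1 := hsplit p p'
    have h2 := hsplit p' p
    simp only [fun i => min_comm (p' i) (p i)] at h2
    rw [hp'] at h2
    rw [hp, ← h2] at h1
    have hfin : ∑ i, min (p i) (p' i) ≠ ⊤ := by
      refine ne_top_of_le_ne_top ENNReal.one_ne_top (h2 ▸ le_add_self)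
    exact ((ENNReal.add_left_inj hfin).1 h1).symm
  have hmtop : m ≠ ⊤ := by
    refine ne_top_of_le_ne_top ENNReal.one_ne_top ?_
    rw [← hp, ← hsplit p p']
    exact le_self_add
  -- This holds also when `m = 0`, where `x = 0` too, so the degenerate case `p = p'` needs no
  -- separate coupling.
  have hcancel : ∀ x : ℝ≥0∞, x ≤ m → m⁻¹ * x * m = x := by
    intro x hx
    rcases eq_or_ne m 0 with h0 | h0
    · rw [h0] at hx ⊢
      simp [le_antisymm hx zero_le]
    · rw [mul_right_comm, ENNReal.inv_mul_cancel h0 hmtop, one_mul]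
  -- Diagonal part for the common mass, plus the normalized product of the excess and the deficit,
  -- both of total mass `m`.
  let w : ι × ι → ℝ≥0∞ := fun q =>
    (if q.1 = q.2 then min (p q.1) (p' q.1) else 0) + m⁻¹ * (p q.1 - p' q.1) * (p' q.2 - p q.2)
  have hw1 : ∀ i, ∑ j, w (i, j) = p i := by
    intro i
    simp only [w, Finset.sum_add_distrib, ← Finset.mul_sum, hm', Finset.sum_ite_eq,
      Finset.mem_univ, if_true]
    rw [hcancel _ (Finset.single_le_sum (f := fun i => p i - p' i) (fun _ _ => zero_le)
      (Finset.mem_univ i)), add_comm]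
    exact tsub_add_min
  have hw2 : ∀ j, ∑ i, w (i, j) = p' j := by
    intro j
    simp only [w, Finset.sum_add_distrib, ← Finset.mul_sum, ← Finset.sum_mul, ← hm,
      Finset.sum_ite_eq', Finset.mem_univ, if_true]
    rw [mul_right_comm, hcancel _ (hm' ▸ Finset.single_le_sum (f := fun i => p' i - p i)
      (fun _ _ => zero_le) (Finset.mem_univ j)), add_comm, min_comm]
    exact tsub_add_min
  refine (transportCost_le_of_isCoupling
    (π := ∑ q : ι × ι, w q • Measure.dirac (a q.1, a q.2)) ⟨?_, ?_⟩).trans ?_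
  · ext s hs
    rw [Measure.map_apply measurable_fst hs]
    simp only [Measure.finsetSum_apply, Measure.smul_apply,
      Measure.dirac_apply' _ (measurable_fst hs), Measure.dirac_apply' _ hs, Fintype.sum_prod_type,
      smul_eq_mul]
    refine Finset.sum_congr rfl fun i _ => ?_
    rw [← hw1 i, Finset.sum_mul]
    rfl
  · ext s hs
    rw [Measure.map_apply measurable_snd hs]
    simp only [Measure.finsetSum_apply, Measure.smul_apply,
      Measure.dirac_apply' _ (measurable_snd hs), Measure.dirac_apply' _ hs,
      Fintype.sum_prod_type_right, smul_eq_mul]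
    refine Finset.sum_congr rfl fun j _ => ?_
    rw [← hw2 j, Finset.sum_mul]
    rfl
  · simp only [lintegral_finsetSum_measure, lintegral_smul_measure, lintegral_dirac' _ hc,
      smul_eq_mul]
    calc ∑ q : ι × ι, w q * c (a q.1) (a q.2)
        ≤ ∑ q : ι × ι, m⁻¹ * (p q.1 - p' q.1) * (p' q.2 - p q.2) * D := by
          refine Finset.sum_le_sum fun q _ => ?_
          simp only [w]
          rw [add_mul]
          split_ifs with h
          · rw [← h, hcc]; simp
          · rw [zero_mul, zero_add]
            gcongr
            exact hD _ _
      _ = D * (m⁻¹ * m * m) := by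
          rw [Fintype.sum_prod_type, ← hm']
          simp only [← Finset.sum_mul, ← Finset.mul_sum]
          rw [hm', ← hm, mul_comm]
      _ = D * m := by rw [hcancel m le_rfl]

theorem map_simpleFunc {X Y : Type*} [MeasurableSpace X] [MeasurableSpace Y]
    (q : SimpleFunc X Y) (hq : Measurable q) (μ : Measure X) :
    μ.map q = ∑ y : q.range, μ (q ⁻¹' {y.1}) • Measure.dirac y.1 := by
  ext s hs
  rw [Finset.sum_coe_sort q.range fun y => μ (q ⁻¹' {y}) • Measure.dirac y]
  have h := SimpleFunc.map_lintegral (s.indicator (1 : Y → ℝ≥0∞)) q (μ := μ)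
  rw [← SimpleFunc.lintegral_eq_lintegral, SimpleFunc.coe_map] at h
  rw [← lintegral_indicator_one hs, lintegral_map (measurable_one.indicator hs) hq]
  refine h.trans ?_
  simp only [Measure.finsetSum_apply, Measure.smul_apply, Measure.dirac_apply' _ hs, smul_eq_mul]
  exact Finset.sum_congr rfl fun y _ => mul_comm _ _

open ProbabilityTheory in
/-- The fluctuations of empirical frequencies are `O(N^{-1/2})` in mean. -/
theorem lintegral_abs_frequency_sub_le {E : Type*} [MeasurableSpace E] (f : Measure E)
    [IsProbabilityMeasure f] {A : Set E} (hA : MeasurableSet A) {N : ℕ} [NeZero N] :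
    ∫⁻ Z : Fin N → E, ENNReal.ofReal
      |(N : ℝ)⁻¹ * (∑ k, A.indicator (1 : E → ℝ) (Z k)) - f.real A| ∂(Measure.pi fun _ => f) ≤
      ENNReal.ofReal (2 * (√N)⁻¹) := by
  set X : E → ℝ := A.indicator 1 with hX
  have hXm : Measurable X := measurable_one.indicator hA
  have hXb : ∀ z, X z ∈ Set.Icc (0 : ℝ) 1 := fun z => by
    by_cases h : z ∈ A <;> simp [X, h]
  have hXL : MemLp X 2 f := memLp_of_bounded (Eventually.of_forall hXb) hXm.aestronglyMeasurable 2
  set Y : (Fin N → E) → ℝ := fun Z => ∑ k, X (Z k) with hY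
  have hYm : Measurable Y := Finset.measurable_sum _ fun k _ => hXm.comp (measurable_pi_apply k)
  have hN : (0 : ℝ) < N := by exact_mod_cast NeZero.pos N
  have hvar : Var[Y; Measure.pi fun _ => f] ≤ N := by
    have h1 := variance_sum_pi (μ := fun _ : Fin N => f) (X := fun _ => X) fun _ => hXL
    have h2 : (∑ i : Fin N, fun Z : Fin N → E => X (Z i)) = Y := by
      funext Z; simp [Y]
    rw [h2] at h1
    rw [h1]
    have h3 := variance_le_sq_of_bounded (Eventually.of_forall hXb) hXm.aemeasurable (μ := f)
    calc ∑ _ : Fin N, Var[X; f] ≤ ∑ _ : Fin N, (1 : ℝ) := by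
          refine Finset.sum_le_sum fun _ _ => h3.trans (by norm_num)
      _ = N := by simp
  have hmean : ∫ Z, Y Z ∂(Measure.pi fun _ : Fin N => f) = N * f.real A := by
    have hXi : Integrable X f := hXL.integrable (by norm_num)
    rw [hY, integral_finsetSum]
    · have : ∀ k : Fin N, ∫ Z : Fin N → E, X (Z k) ∂(Measure.pi fun _ => f) = f.real A := fun k => by
        rw [← integral_indicator_one hA]
        have := (measurePreserving_eval (fun _ : Fin N => f) k)
        rw [← hX]
        conv_rhs => rw [← this.map_eq]
        rw [integral_map (measurable_pi_apply k).aemeasurable hXm.aestronglyMeasurable]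
      simp [this]
    · intro k _
      exact (measurePreserving_eval (fun _ : Fin N => f) k).integrable_comp_of_integrable hXi
  rw [variance_eq_integral hYm.aemeasurable, hmean] at hvar
  have hYb : ∀ Z, |Y Z - N * f.real A| ≤ N := by
    intro Z
    have h1 : 0 ≤ Y Z := Finset.sum_nonneg fun k _ => (hXb _).1
    have h2 : Y Z ≤ N := (Finset.sum_le_sum fun k _ => (hXb (Z k)).2).trans (by simp)
    have h3 : f.real A ≤ 1 := measureReal_le_one
    have h4 : 0 ≤ f.real A := measureReal_nonneg
    rw [abs_le]
    constructor <;> nlinarith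
  have hsq : Integrable (fun Z => (Y Z - N * f.real A) ^ 2) (Measure.pi fun _ : Fin N => f) := by
    refine Integrable.of_bound (by fun_prop) ((N : ℝ) ^ 2) (Eventually.of_forall fun Z => ?_)
    rw [norm_pow, Real.norm_eq_abs]
    gcongr
    exact hYb Z
  set s : ℝ := (√N)⁻¹ with hs
  have hs0 : 0 < s := by positivity
  have hsN : s ^ 2 * N = 1 := by
    rw [hs, inv_pow, Real.sq_sqrt hN.le, inv_mul_cancel₀ hN.ne']
  -- With `s = N^{-1/2}`, this is `s² y ≤ s³ y² + s`, a form of Young's inequality replacing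
  -- Cauchy–Schwarz. As the variance is at most `N = s⁻²`, both terms have mean at most `s`.
  have hpt : ∀ Z : Fin N → E, |(N : ℝ)⁻¹ * Y Z - f.real A| ≤
      s ^ 3 * (Y Z - N * f.real A) ^ 2 + s := by
    intro Z
    have e1 : (N : ℝ)⁻¹ = s ^ 2 := by
      field_simp at hsN ⊢; linarith
    have e2 : (N : ℝ)⁻¹ * Y Z - f.real A = s ^ 2 * (Y Z - N * f.real A) := by
      rw [e1, mul_sub, ← mul_assoc, hsN, one_mul]
    rw [e2, abs_mul, abs_of_pos (by positivity), ← sq_abs (Y Z - N * f.real A)]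
    set y := |Y Z - N * f.real A|
    nlinarith [sq_nonneg (s * y - 1), sq_nonneg (s * y), mul_nonneg hs0.le (sq_nonneg (s * y - 1)),
      mul_nonneg hs0.le (sq_nonneg (s * y))]
  refine (lintegral_mono fun Z => ENNReal.ofReal_le_ofReal (hpt Z)).trans ?_
  have hi : Integrable (fun Z => s ^ 3 * (Y Z - N * f.real A) ^ 2 + s)
      (Measure.pi fun _ : Fin N => f) := (hsq.const_mul _).add (integrable_const _)
  rw [← ofReal_integral_eq_lintegral_ofReal hi
    (Eventually.of_forall fun Z => by positivity)]
  refine ENNReal.ofReal_le_ofReal ?_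
  rw [integral_add (hsq.const_mul _) (integrable_const _), integral_const_mul]
  simp only [integral_const, probReal_univ, one_smul]
  have : s ^ 3 * ∫ Z, (Y Z - N * f.real A) ^ 2 ∂(Measure.pi fun _ : Fin N => f) ≤ s ^ 3 * N := by
    gcongr
  have e : s ^ 3 * N = s := by linear_combination s * hsN
  linarith

variable {d : ℕ}

/-- The mean distance between a measure and the empirical measure of independent samples is
controlled by the quality of a quantization, up to a constant which does not depend on the
measure. -/
theorem exists_lintegral_distMK_empiricalMeasure_le (q : SimpleFunc (Phase d) (Phase d)) :
    ∃ C : ℝ≥0∞, C ≠ ⊤ ∧ ∀ (N : ℕ) [NeZero N] (f : P1 d),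
      ∫⁻ Z : Fin N → Phase d, distMK (empiricalMeasure Z) f ∂(Measure.pi fun _ => f.toMeasure) ≤
        2 * ∫⁻ z, edist (q z) z ∂f.toMeasure + C * ENNReal.ofReal (2 * (√N)⁻¹) := by
  have hq := q.measurable
  -- A crude finite bound for the diameter of the range of `q`; it depends on neither `f` nor `N`.
  set D : ℝ≥0∞ := ∑ a : q.range, ∑ b : q.range, edist a.1 b.1 with hDdef
  have hD : ∀ a b : q.range, edist a.1 b.1 ≤ D := fun a b =>
    (Finset.single_le_sum (f := fun b : q.range => edist a.1 b.1) (fun _ _ => zero_le)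
      (Finset.mem_univ b)).trans (Finset.single_le_sum
        (f := fun a : q.range => ∑ b : q.range, edist a.1 b.1) (fun _ _ => zero_le)
        (Finset.mem_univ a))
  have hDtop : D ≠ ⊤ :=
    ENNReal.sum_ne_top.2 fun a _ => ENNReal.sum_ne_top.2 fun b _ => edist_ne_top _ _
  refine ⟨D * q.range.card, ENNReal.mul_ne_top hDtop (by finiteness), fun N _ f => ?_⟩
  have hqi : Integrable (fun z => q z) f.toMeasure := q.integrable_of_isFiniteMeasure
  let qf : P1 d := P1.law f.toMeasure q hq hqi
  have hNne : (N : ℝ≥0∞) ≠ 0 := by simpa using NeZero.ne N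
  have hmass : ∀ μ : Measure (Phase d), IsProbabilityMeasure μ →
      ∑ y : q.range, μ (q ⁻¹' {y.1}) = 1 := by
    intro μ hμ
    rw [Finset.sum_coe_sort q.range fun y => μ (q ⁻¹' {y}), q.sum_range_measure_preimage_singleton,
      measure_univ]
  have h1 : ∀ Z : Fin N → Phase d, distMK (empiricalMeasure Z) (empiricalMeasure fun k => q (Z k)) ≤
      (N : ℝ≥0∞)⁻¹ * ∑ k, edist (q (Z k)) (Z k) := fun Z => by
    refine (distMK_empiricalMeasure_le _ _).trans (le_of_eq ?_)
    simp only [edist_comm]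
  have h2 : ∀ Z : Fin N → Phase d, distMK (empiricalMeasure fun k => q (Z k)) qf ≤
      D * ∑ y : q.range, ENNReal.ofReal |(N : ℝ)⁻¹ *
        (∑ k, (q ⁻¹' {y.1}).indicator (1 : Phase d → ℝ) (Z k)) - f.toMeasure.real (q ⁻¹' {y.1})| := by
    intro Z
    rw [distMK, empiricalMeasure_comp hq]
    change transportCost _ ((empiricalMeasure Z).toMeasure.map q) (f.toMeasure.map q) ≤ _
    rw [map_simpleFunc q hq, map_simpleFunc q hq]
    refine (transportCost_sum_dirac_le (by fun_prop) (fun x => edist_self x) _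
      (hmass _ inferInstance) (hmass _ inferInstance) hD).trans ?_
    gcongr with y
    have hA : MeasurableSet (q ⁻¹' {y.1}) := q.measurableSet_fiber y.1
    have e : (N : ℝ)⁻¹ * (∑ k, (q ⁻¹' {y.1}).indicator (1 : Phase d → ℝ) (Z k)) =
        (empiricalMeasure Z).toMeasure.real (q ⁻¹' {y.1}) := by
      rw [← integral_indicator_one hA, integral_empiricalMeasure, smul_eq_mul]
    rw [e, ← ENNReal.ofReal_toReal (measure_ne_top (empiricalMeasure Z).toMeasure _),
      ← ENNReal.ofReal_toReal (measure_ne_top f.toMeasure _),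
      ← ENNReal.ofReal_sub _ ENNReal.toReal_nonneg]
    exact ENNReal.ofReal_le_ofReal (le_abs_self _)
  have h3 : distMK qf f ≤ ∫⁻ z, edist (q z) z ∂f.toMeasure := by
    have := transportCost_map_le (c := fun x y : Phase d => edist x y) (π := f.toMeasure)
      hq measurable_id
    rwa [Measure.map_id] at this
  -- Pass through the quantized empirical measure and the quantized `f`. The outer two legs each
  -- cost one mean quantization error, and the middle leg compares frequencies on finitely many
  -- cells.
  have hpt : ∀ Z : Fin N → Phase d, distMK (empiricalMeasure Z) f ≤
      (N : ℝ≥0∞)⁻¹ * ∑ k, edist (q (Z k)) (Z k) +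
      (D * ∑ y : q.range, ENNReal.ofReal |(N : ℝ)⁻¹ *
        (∑ k, (q ⁻¹' {y.1}).indicator (1 : Phase d → ℝ) (Z k)) - f.toMeasure.real (q ⁻¹' {y.1})| +
      ∫⁻ z, edist (q z) z ∂f.toMeasure) := fun Z =>
    (distMK_triangle _ (empiricalMeasure fun k => q (Z k)) _).trans
      (add_le_add (h1 Z) ((distMK_triangle _ qf _).trans (add_le_add (h2 Z) h3)))
  have hem : Measurable fun z => edist (q z) z := hq.edist measurable_id
  have hind : ∀ y : q.range, Measurable fun Z : Fin N → Phase d => ENNReal.ofReal |(N : ℝ)⁻¹ *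
      (∑ k, (q ⁻¹' {y.1}).indicator (1 : Phase d → ℝ) (Z k)) -
        f.toMeasure.real (q ⁻¹' {y.1})| := by
    intro y
    have hA : Measurable ((q ⁻¹' {y.1}).indicator (1 : Phase d → ℝ)) :=
      measurable_one.indicator (q.measurableSet_fiber y.1)
    fun_prop
  have hev : ∀ k : Fin N, ∫⁻ Z : Fin N → Phase d, edist (q (Z k)) (Z k)
      ∂(Measure.pi fun _ => f.toMeasure) = ∫⁻ z, edist (q z) z ∂f.toMeasure := fun k =>
    (measurePreserving_eval (fun _ : Fin N => f.toMeasure) k).lintegral_comp hem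
  refine (lintegral_mono hpt).trans ?_
  rw [lintegral_add_left (by fun_prop), lintegral_add_left (by fun_prop),
    lintegral_const_mul _ (by fun_prop), lintegral_const_mul _ (by fun_prop),
    lintegral_finsetSum _ (by fun_prop), lintegral_finsetSum _ (fun y _ => hind y)]
  simp only [hev, lintegral_const, measure_univ, mul_one, Finset.sum_const, Finset.card_univ,
    Fintype.card_fin, nsmul_eq_mul]
  rw [← mul_assoc, ENNReal.inv_mul_cancel hNne (ENNReal.natCast_ne_top N), one_mul, two_mul,
    add_assoc, add_comm (D * _), mul_assoc D]
  gcongr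
  refine (Finset.sum_le_sum fun y _ => lintegral_abs_frequency_sub_le f.toMeasure
    (q.measurableSet_fiber y.1)).trans (le_of_eq ?_)
  simp

/-! ### Symmetric approximation of measures on `𝒫₁(ℝ^d)` -/

theorem momentMeasure_eq (m : ℕ) (P : Measure (P1 d)) :
    momentMeasure m P = P.bind (piKernel d m) := rfl

instance (m : ℕ) (P : Measure (P1 d)) [IsProbabilityMeasure P] :
    IsProbabilityMeasure (momentMeasure m P) := by
  rw [momentMeasure_eq]; infer_instance

theorem lintegral_momentMeasure (m : ℕ) (P : Measure (P1 d)) {g : (Fin m → Phase d) → ℝ≥0∞}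
    (hg : Measurable g) :
    ∫⁻ Z, g Z ∂momentMeasure m P =
      ∫⁻ f, ∫⁻ Z, g Z ∂(Measure.pi fun _ : Fin m => f.toMeasure) ∂P :=
  Measure.lintegral_bind (measurable_pi_toMeasure m).aemeasurable hg.aemeasurable

theorem lintegral_moment_lt_top {P : Measure (P1 d)} (hP : P ∈ P1P1 d) :
    ∫⁻ f, ∫⁻ z, ‖z‖ₑ ∂f.toMeasure ∂P < ⊤ := by
  simpa only [distMK_dirac_zero] using hP.2

theorem lintegral_sum_enorm_momentMeasure_lt_top {P : Measure (P1 d)} (hP : P ∈ P1P1 d) (m : ℕ) :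
    ∫⁻ Z, ∑ k, ‖Z k‖ₑ ∂momentMeasure m P < ⊤ := by
  rw [lintegral_momentMeasure m P (by fun_prop)]
  have : ∀ f : P1 d, ∫⁻ Z, ∑ k, ‖Z k‖ₑ ∂(Measure.pi fun _ : Fin m => f.toMeasure) =
      m * ∫⁻ z, ‖z‖ₑ ∂f.toMeasure := by
    intro f
    rw [lintegral_finsetSum _ (by fun_prop)]
    simp only [fun k : Fin m => (measurePreserving_eval (fun _ : Fin m => f.toMeasure) k
      ).lintegral_comp (f := fun z : Phase d => ‖z‖ₑ) (by fun_prop)]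
    simp
  simp only [this]
  rw [lintegral_const_mul' _ _ (by finiteness)]
  exact ENNReal.mul_lt_top (by finiteness) (lintegral_moment_lt_top hP)

theorem map_perm_pi {E : Type*} [MeasurableSpace E] (f : Measure E) [SigmaFinite f] {m : ℕ}
    (σ : Equiv.Perm (Fin m)) :
    (Measure.pi fun _ : Fin m => f).map (fun Z k => Z (σ k)) = Measure.pi fun _ => f := by
  refine (Measure.pi_eq fun s hs => ?_).symm
  have hm : Measurable fun (Z : Fin m → E) k => Z (σ k) := by fun_prop
  rw [Measure.map_apply hm (MeasurableSet.univ_pi hs)]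
  have : (fun (Z : Fin m → E) k => Z (σ k)) ⁻¹' Set.univ.pi s =
      Set.univ.pi fun k => s (σ.symm k) := by
    ext Z
    simp only [Set.mem_preimage, Set.mem_univ_pi]
    exact ⟨fun h k => by simpa using h (σ.symm k), fun h k => by simpa using h (σ k)⟩
  rw [this, Measure.pi_pi]
  exact Equiv.prod_comp σ.symm fun k => f (s k)

theorem momentMeasure_mem_symP1 {P : Measure (P1 d)} (hP : P ∈ P1P1 d) (m : ℕ) :
    momentMeasure m P ∈ symP1 d m := by
  have := hP.1
  refine ⟨inferInstance, lintegral_sum_enorm_momentMeasure_lt_top hP m, fun σ => ?_⟩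
  have hm : Measurable fun (Z : Fin m → Phase d) k => Z (σ k) := by fun_prop
  refine Measure.ext_of_lintegral _ fun g hg => ?_
  rw [lintegral_map hg hm, lintegral_momentMeasure m P (g := fun Z => g fun k => Z (σ k)) (hg.comp hm),
    lintegral_momentMeasure _ _ hg]
  refine lintegral_congr fun f => ?_
  conv_rhs => rw [← map_perm_pi f.toMeasure σ]
  rw [lintegral_map hg hm]

open ProbabilityTheory in
-- The inequality requires no measurability of `g`, so it can be used with the cost `distMK`.
theorem lintegral_compProd_le {X Y : Type*} [MeasurableSpace X] [MeasurableSpace Y]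
    (P : Measure X) [SFinite P] (κ : Kernel X Y) [IsSFiniteKernel κ] (g : X × Y → ℝ≥0∞) :
    ∫⁻ p, g p ∂(P ⊗ₘ κ) ≤ ∫⁻ x, ∫⁻ y, g (x, y) ∂κ x ∂P := by
  rw [Measure.compProd_eq_comp_prod]
  refine (Measure.lintegral_bind_le _ _ _).trans (lintegral_mono fun x => ?_)
  rw [Kernel.prod_apply, Kernel.id_apply, Measure.dirac_prod]
  exact lintegral_map_le _ _

open ProbabilityTheory in
-- Draw `f` with law `P`, then `N` independent samples of `f`. The pair formed by their empirical
-- measure and `f` realizes the coupling.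
theorem DistMK_empiricalLaw_momentMeasure_le (P : Measure (P1 d)) [IsProbabilityMeasure P]
    (N : ℕ) [NeZero N] :
    DistMK (empiricalLaw (momentMeasure N P)) P ≤
      ∫⁻ f, ∫⁻ Z : Fin N → Phase d, distMK (empiricalMeasure Z) f
        ∂(Measure.pi fun _ => f.toMeasure) ∂P := by
  have hm : Measurable (empiricalMeasure : (Fin N → Phase d) → P1 d) := measurable_empiricalMeasure
  refine le_trans (le_of_eq ?_) ((transportCost_map_le (c := distMK) (π := P ⊗ₘ piKernel d N)
    (hm.comp measurable_snd) measurable_fst).trans (lintegral_compProd_le _ _ _))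
  change _ = transportCost _ (((P ⊗ₘ piKernel d N).map (empiricalMeasure ∘ Prod.snd)))
    ((P ⊗ₘ piKernel d N).fst)
  rw [Measure.fst_compProd, ← Measure.map_map hm measurable_snd]
  change _ = transportCost _ (((P ⊗ₘ piKernel d N).snd.map empiricalMeasure)) _
  rw [Measure.snd_compProd]
  rfl

/-- Law of large numbers averaged over `P`. The quantizer is chosen first, for the mean measure `ν =
∫ f P(df)`, by dominated convergence with the finite first moment. Then `N` is taken large,
uniformly in `f`. -/
theorem tendsto_DistMK_empiricalLaw_momentMeasure {P : Measure (P1 d)} (hP : P ∈ P1P1 d) :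
    Tendsto (fun n : ℕ => DistMK (empiricalLaw (momentMeasure (n + 1) P)) P) atTop (𝓝 0) := by
  have := hP.1
  let q : ℕ → SimpleFunc (Phase d) (Phase d) := fun j =>
    SimpleFunc.approxOn id measurable_id Set.univ 0 (Set.mem_univ _) j
  set ν : Measure (Phase d) := P.bind P1.toMeasure with hν
  have hbind : ∀ {g : Phase d → ℝ≥0∞}, Measurable g →
      ∫⁻ z, g z ∂ν = ∫⁻ f, ∫⁻ z, g z ∂f.toMeasure ∂P := fun hg =>
    Measure.lintegral_bind measurable_toMeasure.aemeasurable hg.aemeasurable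
  have hqm : ∀ j, Measurable fun z => edist (q j z) z := fun j =>
    (q j).measurable.edist measurable_id
  have hq0 : Tendsto (fun j => ∫⁻ z, edist (q j z) z ∂ν) atTop (𝓝 0) := by
    have h := tendsto_lintegral_of_dominated_convergence (μ := ν)
      (F := fun j z => edist (q j z) z) (f := fun _ => 0) (fun z => ‖z‖ₑ) hqm
      (fun j => Eventually.of_forall fun z => by
        have := SimpleFunc.edist_approxOn_le measurable_id (Set.mem_univ (0 : Phase d)) z j
        rwa [edist_zero_left] at this)
      (by rw [hbind (by fun_prop)]; exact (lintegral_moment_lt_top hP).ne)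
      (Eventually.of_forall fun z => by
        have h1 := SimpleFunc.tendsto_approxOn measurable_id (Set.mem_univ (0 : Phase d))
          (x := z) (by simp)
        exact (tendsto_iff_edist_tendsto_0.1 h1))
    simpa using h
  rw [ENNReal.tendsto_nhds_zero]
  intro ε hε
  have hq0' : Tendsto (fun j => 2 * ∫⁻ z, edist (q j z) z ∂ν) atTop (𝓝 0) := by
    simpa using ENNReal.Tendsto.const_mul hq0 (Or.inr ENNReal.ofNat_ne_top)
  obtain ⟨j, hj⟩ := (hq0'.eventually_lt_const (ENNReal.half_pos hε.ne')).exists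
  obtain ⟨C, hC, hCb⟩ := exists_lintegral_distMK_empiricalMeasure_le (q j)
  have hlim : Tendsto (fun n : ℕ => C * ENNReal.ofReal (2 * (√((n + 1 : ℕ) : ℝ))⁻¹)) atTop
      (𝓝 0) := by
    have h1 : Tendsto (fun n : ℕ => 2 * (√((n + 1 : ℕ) : ℝ))⁻¹) atTop (𝓝 (2 * 0)) :=
      ((Real.tendsto_sqrt_atTop.comp (tendsto_natCast_atTop_atTop.comp
        (tendsto_add_atTop_nat 1))).inv_tendsto_atTop).const_mul 2
    have h2 := ENNReal.Tendsto.const_mul (ENNReal.tendsto_ofReal h1) (Or.inr hC)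
    simpa using h2
  filter_upwards [hlim.eventually_lt_const (ENNReal.half_pos hε.ne')] with n hn
  calc DistMK (empiricalLaw (momentMeasure (n + 1) P)) P
      ≤ ∫⁻ f, (2 * ∫⁻ z, edist (q j z) z ∂f.toMeasure +
          C * ENNReal.ofReal (2 * (√((n + 1 : ℕ) : ℝ))⁻¹)) ∂P :=
        (DistMK_empiricalLaw_momentMeasure_le P (n + 1)).trans (lintegral_mono fun f => hCb _ f)
    _ = 2 * ∫⁻ z, edist (q j z) z ∂ν + C * ENNReal.ofReal (2 * (√((n + 1 : ℕ) : ℝ))⁻¹) := by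
        rw [lintegral_add_right _ measurable_const, lintegral_const_mul' _ _ (by finiteness),
          hbind (hqm j), lintegral_const, measure_univ, mul_one]
    _ ≤ ε / 2 + ε / 2 := by gcongr
    _ = ε := ENNReal.add_halves ε

end Sampling

/-! ### The mean-field hierarchy -/

section Hierarchy

variable {d m : ℕ} {K : Phase d → Phase d → Phase d} {L : NNReal} (hK : IsLipschitzKernel K L)

open ProbabilityTheory in
theorem integral_momentMeasure {P : Measure (P1 d)} [IsProbabilityMeasure P]
    {ψ : (Fin m → Phase d) → ℝ} (hψ : Integrable ψ (momentMeasure m P)) :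
    ∫ Z, ψ Z ∂momentMeasure m P = ∫ f, ∫ Z, ψ Z ∂piKernel d m f ∂P := by
  have h : momentMeasure m P = ((piKernel d m) ∘ₖ (Kernel.const Unit P)) () := by
    rw [momentMeasure_eq, Measure.comp_eq_comp_const_apply]
  rw [h] at hψ ⊢
  rw [Kernel.integral_comp hψ, Kernel.const_apply]

theorem integrable_momentMeasure_of_le {P : Measure (P1 d)} (hP : P ∈ P1P1 d)
    {ψ : (Fin m → Phase d) → ℝ} (hψ : Continuous ψ) {C : ℝ}
    (hC : ∀ Z, |ψ Z| ≤ C * (1 + ∑ k, ‖Z k‖)) : Integrable ψ (momentMeasure m P) := by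
  have := hP.1
  have hs : Integrable (fun Z : Fin m → Phase d => ∑ k, ‖Z k‖) (momentMeasure m P) := by
    refine ⟨(by fun_prop : Continuous fun Z : Fin m → Phase d => ∑ k, ‖Z k‖).aestronglyMeasurable,
      lt_of_eq_of_lt (lintegral_congr fun Z => ?_)
      (lintegral_sum_enorm_momentMeasure_lt_top hP m)⟩
    rw [Real.enorm_of_nonneg (Finset.sum_nonneg fun k _ => norm_nonneg _),
      ENNReal.ofReal_sum_of_nonneg fun k _ => norm_nonneg _]
    simp only [ofReal_norm]
  exact (((integrable_const (1 : ℝ)).add hs).const_mul C).mono' hψ.aestronglyMeasurable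
    (Eventually.of_forall hC)

/-- The characteristics applied to each of `m` particles. -/
def characteristics (f : P1 d) (t : ℝ) (Z : Fin m → Phase d) : Fin m → Phase d :=
  fun k => characteristic hK f t (Z k)

theorem continuous_characteristics (f : P1 d) (t : ℝ) :
    Continuous (characteristics hK f t : (Fin m → Phase d) → _) :=
  continuous_pi fun k => (continuous_characteristic hK f t).comp (continuous_apply k)

theorem piKernel_vlasovFlow (t : ℝ) (f : P1 d) :
    piKernel d m (vlasovFlow hK t f) = (piKernel d m f).map (characteristics hK f t) := by
  have : IsProbabilityMeasure (f.toMeasure.map (characteristic hK f t)) :=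
    (vlasovFlow hK t f).isProbabilityMeasure
  exact (Measure.pi_map_pi (μ := fun _ : Fin m => f.toMeasure) fun _ =>
    (continuous_characteristic hK f t).aemeasurable).symm

theorem integral_piKernel_vlasovFlow (t : ℝ) (f : P1 d) {ψ : (Fin m → Phase d) → ℝ}
    (hψ : Continuous ψ) :
    ∫ Z, ψ Z ∂piKernel d m (vlasovFlow hK t f) =
      ∫ Z, ψ (characteristics hK f t Z) ∂piKernel d m f := by
  rw [piKernel_vlasovFlow, integral_map (continuous_characteristics hK f t).aemeasurable
    hψ.aestronglyMeasurable]

theorem integral_momentMeasure_map_vlasovFlow {P : Measure (P1 d)} (hP : P ∈ P1P1 d) (t : ℝ)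
    {ψ : (Fin m → Phase d) → ℝ} (hψ : Continuous ψ) {C : ℝ}
    (hC : ∀ Z, |ψ Z| ≤ C * (1 + ∑ k, ‖Z k‖)) :
    ∫ Z, ψ Z ∂momentMeasure m (P.map (vlasovFlow hK t)) =
      ∫ f, ∫ Z, ψ (characteristics hK f t Z) ∂piKernel d m f ∂P := by
  have hPt := map_vlasovFlow_mem_P1P1 hK t hP
  have := hPt.1
  rw [integral_momentMeasure (integrable_momentMeasure_of_le hPt hψ hC),
    integral_map (measurable_vlasovFlow hK t).aemeasurable
      hψ.stronglyMeasurable.integral_kernel.aestronglyMeasurable]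
  exact integral_congr_ae (Eventually.of_forall fun f => integral_piKernel_vlasovFlow hK t f hψ)

/-- Rewritten as a kernel integral at `vlasovFlow hK t f`, the function is measurable without
studying how the characteristics depend on `f`. -/
theorem aestronglyMeasurable_integral_characteristics (P : Measure (P1 d)) (t : ℝ)
    {ψ : (Fin m → Phase d) → ℝ} (hψ : Continuous ψ) :
    AEStronglyMeasurable (fun f => ∫ Z, ψ (characteristics hK f t Z) ∂piKernel d m f) P := by
  simp only [← fun f => integral_piKernel_vlasovFlow hK t f hψ]
  exact (hψ.stronglyMeasurable.integral_kernel.comp_measurable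
    (measurable_vlasovFlow hK t)).aestronglyMeasurable

/-- A dominating function for observables of linear growth along the characteristics. -/
def growthBound (L : NNReal) (C τ : ℝ) (f : P1 d) (Z : Fin m → Phase d) : ℝ :=
  C * (1 + ∑ k, growthConst L τ * (‖Z k‖ + f.moment))

theorem abs_characteristics_le {ψ : (Fin m → Phase d) → ℝ} {C : ℝ} (hC0 : 0 ≤ C)
    (hC : ∀ Z, |ψ Z| ≤ C * (1 + ∑ k, ‖Z k‖)) (f : P1 d) {t τ : ℝ} (ht : |t| ≤ τ)
    (Z : Fin m → Phase d) :
    |ψ (characteristics hK f t Z)| ≤ growthBound L C τ f Z := by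
  refine (hC _).trans ?_
  unfold growthBound
  gcongr
  exact norm_characteristic_le hK f ht _

theorem integrable_norm_eval (f : P1 d) (k : Fin m) :
    Integrable (fun Z : Fin m → Phase d => ‖Z k‖) (piKernel d m f) :=
  (measurePreserving_eval (fun _ : Fin m => f.toMeasure) k).integrable_comp_of_integrable
    f.integrable_id.norm

theorem integral_norm_eval (f : P1 d) (k : Fin m) :
    ∫ Z : Fin m → Phase d, ‖Z k‖ ∂piKernel d m f = f.moment := by
  have h := measurePreserving_eval (fun _ : Fin m => f.toMeasure) k
  rw [P1.moment, ← h.map_eq, integral_map (measurable_pi_apply k).aemeasurable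
    continuous_norm.aestronglyMeasurable]
  rfl

theorem integrable_growthBound (C τ : ℝ) (f : P1 d) :
    Integrable (growthBound (m := m) L C τ f) (piKernel d m f) :=
  ((integrable_const _).add (integrable_finsetSum _ fun k _ =>
    ((integrable_norm_eval f k).add (integrable_const _)).const_mul _)).const_mul _

theorem integral_growthBound (C τ : ℝ) (f : P1 d) :
    ∫ Z, growthBound (m := m) L C τ f Z ∂piKernel d m f =
      C * (1 + m * (growthConst L τ * (f.moment + f.moment))) := by
  unfold growthBound
  have hi : ∀ k : Fin m, Integrable (fun Z : Fin m → Phase d => growthConst L τ *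
      (‖Z k‖ + f.moment)) (piKernel d m f) := fun k =>
    ((integrable_norm_eval f k).add (integrable_const _)).const_mul _
  rw [integral_const_mul, integral_add (integrable_const _) (integrable_finsetSum _ fun k _ => hi k),
    integral_finsetSum _ fun k _ => hi k]
  have : ∀ k : Fin m, ∫ Z : Fin m → Phase d, growthConst L τ * (‖Z k‖ + f.moment) ∂piKernel d m f =
      growthConst L τ * (f.moment + f.moment) := fun k => by
    rw [integral_const_mul, integral_add (integrable_norm_eval f k) (integrable_const _),
      integral_norm_eval]
    simp
  simp [this]

theorem integrable_integral_growthBound {P : Measure (P1 d)} (hP : P ∈ P1P1 d) (C τ : ℝ) :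
    Integrable (fun f => ∫ Z, growthBound (m := m) L C τ f Z ∂piKernel d m f) P := by
  have := hP.1
  simp only [integral_growthBound]
  have hM := P1.integrable_moment hP
  exact ((integrable_const _).add (((hM.add hM).const_mul _).const_mul _)).const_mul _

theorem abs_integral_characteristics_le {ψ : (Fin m → Phase d) → ℝ} {C : ℝ} (hC0 : 0 ≤ C)
    (hC : ∀ Z, |ψ Z| ≤ C * (1 + ∑ k, ‖Z k‖)) (f : P1 d) {t τ : ℝ} (ht : |t| ≤ τ) :
    ‖∫ Z, ψ (characteristics hK f t Z) ∂piKernel d m f‖ ≤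
      ∫ Z, growthBound L C τ f Z ∂piKernel d m f :=
  norm_integral_le_of_norm_le (integrable_growthBound C τ f)
    (Eventually.of_forall fun Z => abs_characteristics_le hK hC0 hC f ht Z)

theorem eventually_abs_le (t₀ : ℝ) : ∀ᶠ t in 𝓝 t₀, |t| ≤ |t₀| + 1 := by
  filter_upwards [Metric.ball_mem_nhds t₀ one_pos] with t ht
  rw [Metric.mem_ball, Real.dist_eq] at ht
  linarith [abs_sub_abs_le_abs_sub t t₀]

theorem continuous_characteristics_time (f : P1 d) (Z : Fin m → Phase d) :
    Continuous fun t => characteristics hK f t Z :=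
  continuous_pi fun k => continuous_iff_continuousAt.2 fun t =>
    (hasDerivAt_characteristic hK f t (Z k)).continuousAt

/-- Observables of linear growth have continuous means along the flow. -/
theorem continuous_integral_momentMeasure {P : Measure (P1 d)} (hP : P ∈ P1P1 d)
    {ψ : ℝ × (Fin m → Phase d) → ℝ} (hψ : Continuous ψ) {C : ℝ} (hC0 : 0 ≤ C)
    (hC : ∀ t Z, |ψ (t, Z)| ≤ C * (1 + ∑ k, ‖Z k‖)) :
    Continuous fun t => ∫ Z, ψ (t, Z) ∂momentMeasure m (P.map (vlasovFlow hK t)) := by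
  have hψt : ∀ t, Continuous fun Z => ψ (t, Z) := fun t => by fun_prop
  simp only [fun t => integral_momentMeasure_map_vlasovFlow hK hP t (hψt t) (hC t)]
  refine continuous_iff_continuousAt.2 fun t₀ => ?_
  refine continuousAt_of_dominated (Eventually.of_forall fun t =>
    aestronglyMeasurable_integral_characteristics hK P t (hψt t))
    ((eventually_abs_le t₀).mono fun t ht => Eventually.of_forall fun f =>
      abs_integral_characteristics_le hK hC0 (hC t) f ht)
    (integrable_integral_growthBound hP C _) (Eventually.of_forall fun f => ?_)
  refine continuousAt_of_dominated (Eventually.of_forall fun t =>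
    ((hψt t).comp (continuous_characteristics hK f t)).aestronglyMeasurable)
    ((eventually_abs_le t₀).mono fun t ht => Eventually.of_forall fun Z =>
      abs_characteristics_le hK hC0 (hC t) f ht Z)
    (integrable_growthBound C _ f) (Eventually.of_forall fun Z => ?_)
  exact (hψ.comp (continuous_id.prodMk (continuous_characteristics_time hK f Z))).continuousAt

/-! #### Test functions -/

section TestFunction

variable {φ : ℝ × (Fin m → Phase d) → ℝ}

theorem exists_bound_fderiv (hφ : ContDiff ℝ ∞ φ) (hc : HasCompactSupport φ) :
    ∃ C, 0 ≤ C ∧ (∀ p, |φ p| ≤ C) ∧ ∀ p, ‖fderiv ℝ φ p‖ ≤ C := by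
  obtain ⟨C₁, h₁⟩ := hc.exists_bound_of_continuous hφ.continuous
  obtain ⟨C₂, h₂⟩ := (hc.fderiv ℝ).exists_bound_of_continuous (hφ.continuous_fderiv (by simp))
  exact ⟨max C₁ C₂, ((norm_nonneg _).trans (h₁ 0)).trans (le_max_left _ _),
    fun p => (h₁ p).trans (le_max_left _ _), fun p => (h₂ p).trans (le_max_right _ _)⟩

theorem abs_fderiv_time_le {C : ℝ} (hC : ∀ p, ‖fderiv ℝ φ p‖ ≤ C) (p : ℝ × (Fin m → Phase d)) :
    |fderiv ℝ φ p (1, 0)| ≤ C := by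
  have h := (fderiv ℝ φ p).le_of_opNorm_le (hC p) (1, 0)
  simpa using h

theorem abs_fderiv_single_le {C : ℝ} (hC : ∀ p, ‖fderiv ℝ φ p‖ ≤ C)
    (p : ℝ × (Fin m → Phase d)) (k : Fin m) (v : Phase d) :
    |fderiv ℝ φ p (0, Pi.single k v)| ≤ C * ‖v‖ := by
  have h := (fderiv ℝ φ p).le_of_opNorm_le (hC p) (0, Pi.single k v)
  have e : ‖((0 : ℝ), (Pi.single k v : Fin m → Phase d))‖ = ‖v‖ := by
    rw [Prod.norm_def, norm_zero, Pi.norm_single, max_eq_right (norm_nonneg v)]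
  rwa [e] at h

theorem le_mul_one_add_sum {C : ℝ} (hC : 0 ≤ C) (Z : Fin m → Phase d) :
    C ≤ C * (1 + ∑ k, ‖Z k‖) :=
  le_mul_of_one_le_right hC (le_add_of_nonneg_right (Finset.sum_nonneg fun k _ => norm_nonneg (Z k)))

include hK in
theorem abs_hierarchyTerm_le {C : ℝ} (hC0 : 0 ≤ C) (hC : ∀ p, ‖fderiv ℝ φ p‖ ≤ C) (t : ℝ)
    (Z : Fin (m + 1) → Phase d) :
    |hierarchyTerm K φ t Z| ≤ (m * (C * (2 * L))) * (1 + ∑ k, ‖Z k‖) := by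
  have hk : ∀ j, ‖Z j‖ ≤ 1 + ∑ k, ‖Z k‖ := fun j => by
    have := Finset.single_le_sum (f := fun k => ‖Z k‖) (fun k _ => norm_nonneg _) (Finset.mem_univ j)
    linarith
  have hterm : ∀ k : Fin m, |fderiv ℝ φ (t, fun j => Z j.castSucc)
      (0, Pi.single k (K (Z k.castSucc) (Z (Fin.last m))))| ≤
      C * (2 * L) * (1 + ∑ k, ‖Z k‖) := by
    intro k
    refine (abs_fderiv_single_le hC _ k _).trans ?_
    rw [mul_assoc]
    gcongr
    refine (hK.norm_le _ _).trans ?_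
    rw [mul_comm 2, mul_assoc]
    gcongr
    linarith [hk k.castSucc, hk (Fin.last m)]
  refine (Finset.abs_sum_le_sum_abs _ _).trans ((Finset.sum_le_sum fun k _ => hterm k).trans ?_)
  simp [mul_assoc]

include hK in
theorem continuous_hierarchyTerm (hφ : ContDiff ℝ ∞ φ) :
    Continuous fun p : ℝ × (Fin (m + 1) → Phase d) => hierarchyTerm K φ p.1 p.2 := by
  have h1 := hφ.continuous_fderiv (by simp)
  unfold hierarchyTerm
  refine continuous_finsetSum _ fun k _ => ?_
  refine (h1.comp (by fun_prop)).clm_apply (continuous_const.prodMk ?_)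
  refine (continuous_single k).comp ?_
  exact hK.continuous_uncurry.comp (by fun_prop :
    Continuous fun p : ℝ × (Fin (m + 1) → Phase d) => (p.2 k.castSucc, p.2 (Fin.last m)))

theorem fderiv_apply_eq_sum (p : ℝ × (Fin m → Phase d)) (v : Fin m → Phase d) :
    fderiv ℝ φ p (1, v) = fderiv ℝ φ p (1, 0) + ∑ k, fderiv ℝ φ p (0, Pi.single k (v k)) := by
  rw [← map_sum, ← map_add]
  congr 1
  refine Prod.ext (by simp [Prod.fst_sum]) ?_
  simp [Prod.snd_sum, Finset.univ_sum_single]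

/-- The velocities of the characteristics of `m` particles. -/
def velocities (f : P1 d) (t : ℝ) (Z : Fin m → Phase d) : Fin m → Phase d :=
  fun k => interaction K f.toMeasure (characteristic hK f t) (characteristic hK f t (Z k))

theorem continuous_velocities (f : P1 d) (t : ℝ) :
    Continuous (velocities hK f t : (Fin m → Phase d) → _) :=
  continuous_pi fun k => (hK.continuous_interaction (integrable_characteristic hK f t)).comp
    ((continuous_characteristic hK f t).comp (continuous_apply k))

theorem hasDerivAt_characteristics (f : P1 d) (t : ℝ) (Z : Fin m → Phase d) :
    HasDerivAt (fun s => characteristics hK f s Z) (velocities hK f t Z) t :=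
  hasDerivAt_pi.2 fun k => hasDerivAt_characteristic hK f t (Z k)

theorem integral_piKernel_succ (f : P1 d) {g : (Fin (m + 1) → Phase d) → ℝ}
    (hg : Integrable g (piKernel d (m + 1) f)) :
    ∫ Z, g Z ∂piKernel d (m + 1) f =
      ∫ Z, ∫ z, g (Fin.snoc (α := fun _ => Phase d) Z z) ∂f.toMeasure ∂piKernel d m f := by
  have h := (measurePreserving_piFinSuccAbove (fun _ : Fin (m + 1) => f.toMeasure) (Fin.last m)).symm
  rw [piKernel_apply] at hg ⊢
  rw [← h.map_eq] at hg ⊢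
  rw [integrable_map_equiv] at hg
  rw [integral_map_equiv]
  refine (integral_prod_symm _ hg).trans ?_
  simp only [Function.comp_def, MeasurableEquiv.piFinSuccAbove_symm_apply, Fin.insertNthEquiv_last]
  rfl

/-- For fixed `f` the last particle is independent of the others. Integrating it out commutes with
the linear map `fderiv` and turns `K` into the mean-field velocity. This is the passage from order
`m + 1` to order `m`. -/
theorem integral_hierarchyTerm_characteristics (hφ : ContDiff ℝ ∞ φ) (hc : HasCompactSupport φ)
    (f : P1 d) (t : ℝ) :
    ∫ Z, hierarchyTerm K φ t (characteristics hK f t Z) ∂piKernel d (m + 1) f =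
      ∫ Z, ∑ k, fderiv ℝ φ (t, characteristics hK f t Z) (0, Pi.single k (velocities hK f t Z k))
        ∂piKernel d m f := by
  obtain ⟨C, hC0, -, hC⟩ := exists_bound_fderiv hφ hc
  have hcont : Continuous fun Z : Fin (m + 1) → Phase d =>
      hierarchyTerm K φ t (characteristics hK f t Z) :=
    (continuous_hierarchyTerm hK hφ).comp
      (continuous_const.prodMk (continuous_characteristics hK f t))
  rw [integral_piKernel_succ f ((integrable_growthBound _ _ f).mono' hcont.aestronglyMeasurable
    (Eventually.of_forall fun Z => abs_characteristics_le hK (by positivity)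
      (abs_hierarchyTerm_le hK hC0 hC t) f le_rfl Z))]
  refine integral_congr_ae (Eventually.of_forall fun Z => ?_)
  simp only [hierarchyTerm, characteristics, Fin.snoc_castSucc, Fin.snoc_last]
  have hKi : ∀ k : Fin m, Integrable (fun z => K (characteristic hK f t (Z k))
      (characteristic hK f t z)) f.toMeasure := fun k =>
    hK.integrable (integrable_characteristic hK f t) _
  have hlin : ∀ k : Fin m, ∃ ℓ : Phase d →L[ℝ] ℝ, ∀ v, ℓ v =
      fderiv ℝ φ (t, fun k => characteristic hK f t (Z k)) (0, Pi.single k v) := fun k =>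
    ⟨(fderiv ℝ φ (t, fun k => characteristic hK f t (Z k))).comp
      ((ContinuousLinearMap.inr ℝ ℝ (Fin m → Phase d)).comp
        (ContinuousLinearMap.single ℝ (fun _ : Fin m => Phase d) k)), fun v => rfl⟩
  choose ℓ hℓ using hlin
  simp only [← hℓ]
  rw [integral_finsetSum _ fun k _ => (ℓ k).integrable_comp (hKi k)]
  exact Finset.sum_congr rfl fun k _ =>
    ((ℓ k).integral_comp_comm (hKi k)).trans (hℓ k _)

end TestFunction

end Hierarchy

/-! ### Time evolution of the moment measures -/

section HierarchySolution

variable {d m : ℕ} {K : Phase d → Phase d → Phase d} {L : NNReal} (hK : IsLipschitzKernel K L)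
  {φ : ℝ × (Fin m → Phase d) → ℝ}

/-- Chain rule along the characteristics, then differentiation under `f^{⊗m}`. Since the velocities
grow linearly, the domination is by `growthBound`, uniformly for times near `t`. -/
theorem hasDerivAt_integral_characteristics (hφ : ContDiff ℝ ∞ φ) (hc : HasCompactSupport φ)
    (f : P1 d) (t : ℝ) :
    HasDerivAt (fun s => ∫ Z, φ (s, characteristics hK f s Z) ∂piKernel d m f)
      (∫ Z, fderiv ℝ φ (t, characteristics hK f t Z) (1, 0) ∂piKernel d m f +
        ∫ Z, hierarchyTerm K φ t (characteristics hK f t Z) ∂piKernel d (m + 1) f) t := by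
  obtain ⟨C, hC0, hCφ, hC⟩ := exists_bound_fderiv hφ hc
  have hφ' := hφ.continuous_fderiv (by simp)
  have hcs := fun s => continuous_characteristics (m := m) hK f s
  have hvs := fun s => continuous_velocities (m := m) hK f s
  have hcont : ∀ s, Continuous fun Z : Fin m → Phase d => φ (s, characteristics hK f s Z) :=
    fun s => hφ.continuous.comp (continuous_const.prodMk (hcs s))
  have hfd : Continuous fun Z : Fin m → Phase d => fderiv ℝ φ (t, characteristics hK f t Z) :=
    hφ'.comp (continuous_const.prodMk (hcs t))
  have hcont' : Continuous fun Z : Fin m → Phase d =>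
      fderiv ℝ φ (t, characteristics hK f t Z) (1, velocities hK f t Z) :=
    hfd.clm_apply (continuous_const.prodMk (hvs t))
  have hbound : ∀ s, |s| ≤ |t| + 1 → ∀ Z : Fin m → Phase d,
      ‖fderiv ℝ φ (s, characteristics hK f s Z) (1, velocities hK f s Z)‖ ≤
        growthBound L C (|t| + 1) f Z := by
    intro s hs Z
    rw [fderiv_apply_eq_sum, Real.norm_eq_abs]
    have h1 := abs_fderiv_time_le hC (s, characteristics hK f s Z)
    have h2 : ∀ k, |fderiv ℝ φ (s, characteristics hK f s Z)
        (0, Pi.single k (velocities hK f s Z k))| ≤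
        C * (growthConst L (|t| + 1) * (‖Z k‖ + f.moment)) := fun k =>
      (abs_fderiv_single_le hC _ k _).trans
        (mul_le_mul_of_nonneg_left (norm_velocity_le hK f hs (Z k)) hC0)
    refine (abs_add_le _ _).trans ((add_le_add h1 ((Finset.abs_sum_le_sum_abs _ _).trans
      (Finset.sum_le_sum fun k _ => h2 k))).trans (le_of_eq ?_))
    rw [growthBound, mul_add, mul_one, Finset.mul_sum]
  have hmem : {s : ℝ | |s| ≤ |t| + 1} ∈ 𝓝 t := eventually_abs_le t
  have h := (hasDerivAt_integral_of_dominated_loc_of_deriv_le (μ := piKernel d m f)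
    (F := fun s Z => φ (s, characteristics hK f s Z))
    (F' := fun s Z => fderiv ℝ φ (s, characteristics hK f s Z) (1, velocities hK f s Z))
    hmem (Eventually.of_forall fun s => (hcont s).aestronglyMeasurable)
    (Integrable.of_bound (hcont t).aestronglyMeasurable C (Eventually.of_forall fun Z => hCφ _))
    hcont'.aestronglyMeasurable
    (Eventually.of_forall fun Z s hs => hbound s hs Z) (integrable_growthBound C _ f)
    (Eventually.of_forall fun Z s _ => ?_)).2
  · refine h.congr_deriv ?_
    rw [integral_hierarchyTerm_characteristics hK hφ hc]
    have hi1 : Integrable (fun Z : Fin m → Phase d =>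
        fderiv ℝ φ (t, characteristics hK f t Z) (1, 0)) (piKernel d m f) :=
      Integrable.of_bound (hfd.clm_apply continuous_const).aestronglyMeasurable C
        (Eventually.of_forall fun Z => abs_fderiv_time_le hC _)
    have hi2 : Integrable (fun Z : Fin m → Phase d =>
        fderiv ℝ φ (t, characteristics hK f t Z) (1, velocities hK f t Z)) (piKernel d m f) :=
      (integrable_growthBound C _ f).mono' hcont'.aestronglyMeasurable
        (Eventually.of_forall fun Z => hbound t (by simp) Z)
    have hi3 := hi2.sub hi1
    rw [← integral_add hi1 (hi3.congr (Eventually.of_forall fun Z => ?_))]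
    · exact integral_congr_ae (Eventually.of_forall fun Z => fderiv_apply_eq_sum _ _)
    · simp only [Pi.sub_apply]
      rw [fderiv_apply_eq_sum, add_sub_cancel_left]
  · have hd := (hφ.differentiable (by simp) (s, characteristics hK f s Z)).hasFDerivAt
    exact hd.comp_hasDerivAt s ((hasDerivAt_id s).prodMk (hasDerivAt_characteristics hK f s Z))

theorem hasDerivAt_integral_momentMeasure {P : Measure (P1 d)} (hP : P ∈ P1P1 d)
    (hφ : ContDiff ℝ ∞ φ) (hc : HasCompactSupport φ) (t : ℝ) :
    HasDerivAt (fun s => ∫ Z, φ (s, Z) ∂momentMeasure m (P.map (vlasovFlow hK s)))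
      (∫ Z, fderiv ℝ φ (t, Z) (1, 0) ∂momentMeasure m (P.map (vlasovFlow hK t)) +
        ∫ Z, hierarchyTerm K φ t Z ∂momentMeasure (m + 1) (P.map (vlasovFlow hK t))) t := by
  have hPp := hP.1
  obtain ⟨C, hC0, hCφ, hC⟩ := exists_bound_fderiv hφ hc
  have hφ' := hφ.continuous_fderiv (by simp)
  have c0 : ∀ s, Continuous fun Z => φ (s, Z) := fun s => hφ.continuous.comp (by fun_prop)
  have c1 : ∀ s, Continuous fun Z => fderiv ℝ φ (s, Z) (1, 0) := fun s =>
    (hφ'.comp (by fun_prop)).clm_apply continuous_const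
  have c2 : ∀ s, Continuous fun Z => hierarchyTerm K φ s Z := fun s =>
    (continuous_hierarchyTerm hK hφ).comp (Continuous.prodMk_right s)
  have b0 : ∀ s (Z : Fin m → Phase d), |φ (s, Z)| ≤ C * (1 + ∑ k, ‖Z k‖) := fun s Z =>
    (hCφ _).trans (le_mul_one_add_sum hC0 Z)
  have b1 : ∀ s (Z : Fin m → Phase d), |fderiv ℝ φ (s, Z) (1, 0)| ≤ C * (1 + ∑ k, ‖Z k‖) :=
    fun s Z => (abs_fderiv_time_le hC _).trans (le_mul_one_add_sum hC0 Z)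
  have b2 := abs_hierarchyTerm_le (φ := φ) hK hC0 hC
  have hC2 : 0 ≤ m * (C * (2 * L)) := by positivity
  simp only [fun s => integral_momentMeasure_map_vlasovFlow hK hP s (c0 s) (b0 s)]
  rw [integral_momentMeasure_map_vlasovFlow hK hP t (c1 t) (b1 t),
    integral_momentMeasure_map_vlasovFlow hK hP t (c2 t) (b2 t)]
  have m1 := aestronglyMeasurable_integral_characteristics hK P t (c1 t)
  have m2 := aestronglyMeasurable_integral_characteristics hK P t (c2 t)
  have i1 := (integrable_integral_growthBound (m := m) (L := L) hP C |t|).mono' m1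
    (Eventually.of_forall fun f => abs_integral_characteristics_le hK hC0 (b1 t) f le_rfl)
  have i2 := (integrable_integral_growthBound (m := m + 1) (L := L) hP _ |t|).mono' m2
    (Eventually.of_forall fun f => abs_integral_characteristics_le hK hC2 (b2 t) f le_rfl)
  rw [← integral_add i1 i2]
  have hmem : {s : ℝ | |s| ≤ |t| + 1} ∈ 𝓝 t := eventually_abs_le t
  exact (hasDerivAt_integral_of_dominated_loc_of_deriv_le (μ := P)
    (F := fun s f => ∫ Z, φ (s, characteristics hK f s Z) ∂piKernel d m f)
    (F' := fun s f => ∫ Z, fderiv ℝ φ (s, characteristics hK f s Z) (1, 0) ∂piKernel d m f +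
        ∫ Z, hierarchyTerm K φ s (characteristics hK f s Z) ∂piKernel d (m + 1) f)
    hmem (Eventually.of_forall fun s =>
      aestronglyMeasurable_integral_characteristics hK P s (c0 s))
    ((integrable_integral_growthBound (m := m) (L := L) hP C |t|).mono'
      (aestronglyMeasurable_integral_characteristics hK P t (c0 t))
      (Eventually.of_forall fun f => abs_integral_characteristics_le hK hC0 (b0 t) f le_rfl))
    (m1.add m2)
    (Eventually.of_forall fun f s hs => norm_add_le_of_le
      (abs_integral_characteristics_le hK hC0 (b1 s) f hs)
      (abs_integral_characteristics_le hK hC2 (b2 s) f hs))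
    ((integrable_integral_growthBound hP C _).add (integrable_integral_growthBound hP _ _))
    (Eventually.of_forall fun f s _ =>
      hasDerivAt_integral_characteristics hK hφ hc f s)).2

/-- The sum of the two terms of the weak equation is the time derivative of `∫ φ(t, ·) dP_m(t)`,
which vanishes outside a compact set of times, so its integral is zero. -/
theorem isHierarchySolution_vlasovFlow {P : Measure (P1 d)} (hP : P ∈ P1P1 d) :
    IsHierarchySolution K (fun m => momentMeasure m P)
      (fun m t => momentMeasure m (P.map (vlasovFlow hK t))) := by
  intro m _
  refine ⟨?_, fun φ hφ hc => ?_⟩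
  · have : (vlasovFlow hK 0 : P1 d → P1 d) = id := funext fun f => vlasovFlow_zero hK f
    simp only [this, Measure.map_id]
  obtain ⟨C, hC0, hCφ, hC⟩ := exists_bound_fderiv hφ hc
  have hφ' := hφ.continuous_fderiv (by simp)
  have c0 := hφ.continuous
  have c1 : Continuous fun p => fderiv ℝ φ p (1, 0) := hφ'.clm_apply continuous_const
  have c2 := continuous_hierarchyTerm (m := m) hK hφ
  have b0 : ∀ s (Z : Fin m → Phase d), |φ (s, Z)| ≤ C * (1 + ∑ k, ‖Z k‖) := fun s Z =>
    (hCφ _).trans (le_mul_one_add_sum hC0 Z)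
  have b1 : ∀ s (Z : Fin m → Phase d), |fderiv ℝ φ (s, Z) (1, 0)| ≤ C * (1 + ∑ k, ‖Z k‖) :=
    fun s Z => (abs_fderiv_time_le hC _).trans (le_mul_one_add_sum hC0 Z)
  have b2 := abs_hierarchyTerm_le (φ := φ) hK hC0 hC
  have hC2 : 0 ≤ m * (C * (2 * L)) := by positivity
  have hcomp : IsCompact (Prod.fst '' tsupport φ) := IsCompact.image hc continuous_fst
  have z0 : ∀ t ∉ Prod.fst '' tsupport φ, ∀ Z, φ (t, Z) = 0 := fun t ht Z =>
    image_eq_zero_of_notMem_tsupport fun h => ht ⟨_, h, rfl⟩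
  have z1 : ∀ t ∉ Prod.fst '' tsupport φ, ∀ Z, fderiv ℝ φ (t, Z) = 0 := fun t ht Z =>
    Function.notMem_support.1 fun h => ht ⟨_, support_fderiv_subset ℝ h, rfl⟩
  have key : ∀ {g : ℝ → ℝ}, Continuous g → (∀ t ∉ Prod.fst '' tsupport φ, g t = 0) →
      Integrable g := fun hg h0 =>
    hg.integrable_of_hasCompactSupport (HasCompactSupport.of_support_subset_isCompact hcomp
      fun t ht => by_contra fun hn => ht (h0 t hn))
  have i0 := key (continuous_integral_momentMeasure hK hP c0 hC0 b0)
    fun t ht => by simp [z0 t ht]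
  have i1 := key (continuous_integral_momentMeasure hK hP c1 hC0 b1)
    fun t ht => by simp [z1 t ht]
  have i2 := key (continuous_integral_momentMeasure hK hP c2 hC2 b2)
    fun t ht => by simp [hierarchyTerm, z1 t ht]
  refine ⟨fun t => integrable_momentMeasure_of_le (map_vlasovFlow_mem_P1P1 hK t hP)
      (c1.comp (Continuous.prodMk_right t)) (b1 t),
    fun t => integrable_momentMeasure_of_le (map_vlasovFlow_mem_P1P1 hK t hP)
      (c2.comp (Continuous.prodMk_right t)) (b2 t), i1, i2, ?_⟩
  rw [← integral_add i1 i2]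
  exact integral_eq_zero_of_hasDerivAt_of_integrable
    (hasDerivAt_integral_momentMeasure hK hP hφ hc) (i1.add i2) i0

end HierarchySolution

/-! ### The mean-field limit -/

section MeanFieldLimit

variable {d : ℕ} {K : Phase d → Phase d → Phase d}

/-- Antisymmetry enters through `K z z = 0`: then `K z z' = K z z' - K z z` is bounded by the
Lipschitz condition. The constant becomes `L.toNNReal`, since `L` is an arbitrary real number. -/
theorem isLipschitzKernel_of_antisymm {L : ℝ} (hKanti : ∀ z z', K z z' + K z' z = 0)
    (hKlip₁ : ∀ z₁ z₂ z', ‖K z₁ z' - K z₂ z'‖ ≤ L * ‖z₁ - z₂‖)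
    (hKlip₂ : ∀ z z₁ z₂, ‖K z z₁ - K z z₂‖ ≤ L * ‖z₁ - z₂‖) :
    IsLipschitzKernel K L.toNNReal := by
  have hL : ∀ x : Phase d, L * ‖x‖ ≤ L.toNNReal * ‖x‖ := fun x =>
    mul_le_mul_of_nonneg_right (Real.le_coe_toNNReal L) (norm_nonneg x)
  refine ⟨fun z₁ z₂ z' => (hKlip₁ z₁ z₂ z').trans (hL _),
    fun z z₁ z₂ => (hKlip₂ z z₁ z₂).trans (hL _), fun z z' => ?_⟩
  have h0 : K z z = 0 := by
    have h := hKanti z z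
    rwa [← two_smul ℝ, smul_eq_zero_iff_right two_ne_zero] at h
  have h := (hKlip₂ z z' z).trans (hL _)
  rw [h0, sub_zero] at h
  refine h.trans ?_
  gcongr
  rw [add_comm]
  exact norm_sub_le z' z

/-- The group of maps of `ℰ` induced by the Vlasov flow. -/
def meanFieldFlow {L : NNReal} (hK : IsLipschitzKernel K L) (t : ℝ) (P : setE d) : setE d :=
  ⟨(P : Measure (P1 d)).map (vlasovFlow hK t), map_vlasovFlow_mem_setE hK t P.2⟩

/-- A negative Lipschitz constant forces the phase space to be a single point. This covers the case
of (d) in which `L.toNNReal = 0` would give a weaker exponential than `L`. -/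
theorem DistMK_eq_zero_of_neg {L : ℝ} (hL : L < 0)
    (hKlip₁ : ∀ z₁ z₂ z', ‖K z₁ z' - K z₂ z'‖ ≤ L * ‖z₁ - z₂‖) {P Q : Measure (P1 d)}
    [IsProbabilityMeasure P] [IsProbabilityMeasure Q] : DistMK P Q = 0 := by
  have hz : ∀ z₁ z₂ : Phase d, z₁ = z₂ := fun z₁ z₂ => by
    have h := (norm_nonneg _).trans (hKlip₁ z₁ z₂ 0)
    rw [← sub_eq_zero, ← norm_eq_zero]
    nlinarith [norm_nonneg (z₁ - z₂)]
  have h0 : ∀ f : P1 d, distMK f (P1.dirac 0) = 0 := fun f => by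
    rw [distMK_dirac_zero]
    simp [fun z => hz z 0]
  have hd : ∀ f g : P1 d, distMK f g = 0 := fun f g =>
    le_antisymm ((distMK_triangle f (P1.dirac 0) g).trans (by
      rw [h0, distMK_comm, h0, add_zero])) zero_le
  refine le_antisymm ((transportCost_le_of_isCoupling (π := P.prod Q) ⟨?_, ?_⟩).trans ?_) zero_le
  · exact (Measure.fst_prod (μ := P) (ν := Q))
  · exact (Measure.snd_prod (μ := P) (ν := Q))
  · simp [hd]

end MeanFieldLimit

end

theorem mainTheorem2 (d : ℕ) (K : Phase d → Phase d → Phase d) (L : ℝ)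
    (hKcont : Continuous fun p : Phase d × Phase d => K p.1 p.2)
    (hKanti : ∀ z z', K z z' + K z' z = 0)
    (hKlip₁ : ∀ z₁ z₂ z', ‖K z₁ z' - K z₂ z'‖ ≤ L * ‖z₁ - z₂‖)
    (hKlip₂ : ∀ z z₁ z₂, ‖K z z₁ - K z z₂‖ ≤ L * ‖z₁ - z₂‖) :
    ∃! T : ℝ → setE d → setE d,
      -- one-parameter group
      (∀ P, T 0 P = P) ∧ (∀ s t P, T (s + t) P = T s (T t P)) ∧
      -- (a) mean-field limit, uniform on compact time intervals; the particle number is `n + 1`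
      (∀ (Pin : setE d) (PN : ∀ n : ℕ, Measure (Fin (n + 1) → Phase d)),
        (∀ n, PN n ∈ symP1 d (n + 1)) →
        Tendsto (fun n => DistMK (empiricalLaw (PN n)) (Pin : Measure (P1 d))) atTop (𝓝 0) →
        ∀ τ : ℝ, 0 < τ → ∀ ε : ℝ≥0∞, 0 < ε → ∀ᶠ n in atTop, ∀ t ∈ Set.Icc (-τ) τ,
          DistMK (empiricalLaw ((PN n).map (nBodyFlow K (n + 1) t)))
            (T t Pin : Measure (P1 d)) < ε) ∧
      -- (b) continuity in time
      (∀ (Pin : setE d) (t₀ : ℝ),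
        Tendsto (fun t => DistMK (T t Pin : Measure (P1 d)) (T t₀ Pin : Measure (P1 d)))
          (𝓝 t₀) (𝓝 0)) ∧
      -- (c) the moments solve the infinite mean-field hierarchy
      (∀ Pin : setE d, IsHierarchySolution K
        (fun m => momentMeasure m (Pin : Measure (P1 d)))
        (fun m t => momentMeasure m (T t Pin : Measure (P1 d)))) ∧
      -- (d) stability
      (∀ (Pin Qin : setE d) (t : ℝ),
        DistMK (T t Pin : Measure (P1 d)) (T t Qin : Measure (P1 d)) ≤
          ENNReal.ofReal (Real.exp (2 * L * |t|)) *
            DistMK (Pin : Measure (P1 d)) (Qin : Measure (P1 d))) := by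

  have hK := isLipschitzKernel_of_antisymm hKanti hKlip₁ hKlip₂
  have hlim : ∀ (Pin : setE d) (PN : ∀ n : ℕ, Measure (Fin (n + 1) → Phase d)),
      Tendsto (fun n => DistMK (empiricalLaw (PN n)) (Pin : Measure (P1 d))) atTop (𝓝 0) →
      ∀ τ : ℝ, ∀ ε : ℝ≥0∞, 0 < ε → ∀ᶠ n in atTop, ∀ t ∈ Set.Icc (-τ) τ,
        DistMK (empiricalLaw ((PN n).map (nBodyFlow K (n + 1) t)))
          (meanFieldFlow hK t Pin : Measure (P1 d)) < ε := by
    intro Pin PN hPN τ ε hε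
    -- The stability constant at time `τ` bounds those at all `t` with `|t| ≤ τ`, hence the
    -- uniformity.
    have h := ENNReal.Tendsto.const_mul (a := ENNReal.ofReal (Real.exp (2 * L.toNNReal * τ))) hPN
      (Or.inr ENNReal.ofReal_ne_top)
    rw [mul_zero] at h
    filter_upwards [h.eventually_lt_const hε] with n hn t ht
    refine lt_of_le_of_lt ?_ hn
    rw [empiricalLaw_map_nBodyFlow hK]
    refine (DistMK_map_vlasovFlow_le hK t _ _).trans ?_
    gcongr
    exact abs_le.2 ht
  refine ⟨meanFieldFlow hK, ⟨fun P => ?_, fun s t P => ?_, fun Pin PN _ hPN τ _ => hlim Pin PN hPN τ,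
    fun Pin t₀ => tendsto_DistMK_map_vlasovFlow hK Pin.2.1 t₀,
    fun Pin => isHierarchySolution_vlasovFlow hK Pin.2.1, fun Pin Qin t => ?_⟩,
    fun T ⟨_, _, hT, _⟩ => funext fun t => funext fun P => Subtype.ext ?_⟩
  · refine Subtype.ext ?_
    have : (vlasovFlow hK 0 : P1 d → P1 d) = id := funext fun f => vlasovFlow_zero hK f
    simp only [meanFieldFlow, this, Measure.map_id]
  · refine Subtype.ext ?_
    simp only [meanFieldFlow]
    rw [Measure.map_map (measurable_vlasovFlow hK s) (measurable_vlasovFlow hK t)]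
    congr 1
    exact funext fun f => vlasovFlow_add hK s t f
  · rcases lt_or_ge L 0 with hL | hL
    · have h1 := (meanFieldFlow hK t Pin).2.1.1
      have h2 := (meanFieldFlow hK t Qin).2.1.1
      rw [DistMK_eq_zero_of_neg hL hKlip₁]
      exact zero_le
    · have h := DistMK_map_vlasovFlow_le hK t (Pin : Measure (P1 d)) Qin
      rwa [Real.coe_toNNReal L hL] at h
  · have h1 := (T t P).2.1.1
    have h2 := (meanFieldFlow hK t P).2.1.1
    -- The symmetric approximation of `P` is evolved by the N-body flow. By (a), both `T t P` and
    -- `meanFieldFlow hK t P` are limits of the resulting sequence.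
    have hPN := tendsto_DistMK_empiricalLaw_momentMeasure P.2.1
    -- The bound `|t| + 1` is positive even for `t = 0`, as (a) requires.
    have ht : t ∈ Set.Icc (-(|t| + 1)) (|t| + 1) := abs_le.1 (by linarith)
    have hconv : ∀ S : ℝ → setE d → setE d, (∀ ε : ℝ≥0∞, 0 < ε → ∀ᶠ n in atTop,
        ∀ t' ∈ Set.Icc (-(|t| + 1)) (|t| + 1),
        DistMK (empiricalLaw ((momentMeasure (n + 1) (P : Measure (P1 d))).map
          (nBodyFlow K (n + 1) t'))) (S t' P : Measure (P1 d)) < ε) →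
        Tendsto (fun n : ℕ => transportCost (fun x y : P1 d => edist x y)
          (empiricalLaw ((momentMeasure (n + 1) (P : Measure (P1 d))).map
          (nBodyFlow K (n + 1) t))) (S t P : Measure (P1 d))) atTop (𝓝 0) := fun S hS =>
      ENNReal.tendsto_nhds_zero.2 fun ε hε => (hS ε hε).mono fun n hn => (hn t ht).le
    exact eq_of_tendsto_transportCost
      (hconv T (hT P _ (fun n => momentMeasure_mem_symP1 P.2.1 (n + 1)) hPN _ (by positivity)))
      (hconv (meanFieldFlow hK) (hlim P _ hPN _))
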